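/- Let $\mathcal A$ be an exact category (in the sense of Quillen) which is idempotent complete, and let $\mathbf D^b(\mathcal A)$ be its bounded derived category, i.e. the Verdier quotient of the homotopy category $\mathbf K^b(\mathcal A)$ of bounded complexes by the acyclic complexes. Identify $\mathcal A$ with the full subcategory of $\mathbf D^b(\mathcal A)$ consisting of the complexes concentrated in degree zero. A full subcategory $\mathcal C$ of $\mathcal A$ is called *thick* if it is closed under direct factors and, for every exact sequence $0\to X\to Y\to Z\to 0$ in $\mathcal A$ with two terms in $\mathcal C$, the third term belongs to $\mathcal C$ as well. A thick subcategory $\mathcal C$ of $\mathcal A$ is called *cofinal* if for every admissible epimorphism $Y\to Z$ with $Z\in\mathcal C$ there is an admissible epimorphism $Y'\to Z$ with $Y'\in\mathcal C$ which factors through $Y\to Z$. A full subcategory of a triangulated category is called *thick* if it is closed under shifts, mapping cones, and direct factors. Let $\mathcal C$ be a full subcategory of $\mathcal A$. 1. If $\mathcal C$ is a cofinal thick subcategory of $\mathcal A$, then $\mathcal C=\mathcal D\cap\mathcal A$ for some thick subcategory $\mathcal D$ of $\mathbf D^b(\mathcal A)$. 2. Conversely, if $\mathcal C=\mathcal D\cap\mathcal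 A$ for some thick subcategory $\mathcal D$ of $\mathbf D^b(\mathcal A)$, then $\mathcal C$ is a thick subcategory of $\mathcal A$. -/

import Mathlib

open CategoryTheory Category Limits Pretriangulated ZeroObject

universe v u

/-- `i` is an admissible monomorphism for the class `conf` of short exact sequences. -/
def IsAdmissibleMono {A : Type u} [Category.{v} A] [Preadditive A]
    (conf : ObjectProperty (ShortComplex A)) {X Y : A} (i : X ⟶ Y) : Prop :=
  ∃ (Z : A) (p : Y ⟶ Z) (w : i ≫ p = 0), conf (ShortComplex.mk i p w)

/-- `p` is an admissible epimorphism for the class `conf` of short exact sequences. -/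
def IsAdmissibleEpi {A : Type u} [Category.{v} A] [Preadditive A]
    (conf : ObjectProperty (ShortComplex A)) {Y Z : A} (p : Y ⟶ Z) : Prop :=
  ∃ (X : A) (i : X ⟶ Y) (w : i ≫ p = 0), conf (ShortComplex.mk i p w)

/-- An exact structure in the sense of Quillen on an additive category: a class of
kernel-cokernel pairs (the exact sequences `0 ⟶ X ⟶ Y ⟶ Z ⟶ 0`), closed under isomorphisms and
satisfying Quillen's axioms (in the self-dual form of Keller and Bühler). -/
structure ExactStructure (A : Type u) [Category.{v} A] [Preadditive A] where
  /-- the exact sequences -/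
  exact : ObjectProperty (ShortComplex A)
  exact_of_iso : ∀ {S T : ShortComplex A}, (S ≅ T) → exact S → exact T
  isKernel : ∀ S : ShortComplex A, exact S → Nonempty (IsLimit (KernelFork.ofι S.f S.zero))
  isCokernel : ∀ S : ShortComplex A, exact S → Nonempty (IsColimit (CokernelCofork.ofπ S.g S.zero))
  mono_id : ∀ X : A, IsAdmissibleMono exact (𝟙 X)
  epi_id : ∀ X : A, IsAdmissibleEpi exact (𝟙 X)
  mono_comp : ∀ {X Y Z : A} (i : X ⟶ Y) (j : Y ⟶ Z),
    IsAdmissibleMono exact i → IsAdmissibleMono exact j → IsAdmissibleMono exact (i ≫ j)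
  epi_comp : ∀ {X Y Z : A} (p : X ⟶ Y) (q : Y ⟶ Z),
    IsAdmissibleEpi exact p → IsAdmissibleEpi exact q → IsAdmissibleEpi exact (p ≫ q)
  pushout : ∀ {X Y X' : A} (i : X ⟶ Y) (f : X ⟶ X'), IsAdmissibleMono exact i →
    ∃ (Y' : A) (f' : Y ⟶ Y') (i' : X' ⟶ Y'), IsPushout i f f' i' ∧ IsAdmissibleMono exact i'
  pullback : ∀ {Y Z Z' : A} (p : Y ⟶ Z) (f : Z' ⟶ Z), IsAdmissibleEpi exact p →
    ∃ (Y' : A) (f' : Y' ⟶ Y) (p' : Y' ⟶ Z'), IsPullback f' p' p f ∧ IsAdmissibleEpi exact p'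

namespace ExactStructure

variable {A : Type u} [Category.{v} A] [Preadditive A] (E : ExactStructure A)

section Basic

variable {E}

lemma exists_lift {X Y Z : A} {i : X ⟶ Y} {p : Y ⟶ Z} {w : i ≫ p = 0}
    (h : E.exact (ShortComplex.mk i p w)) {T : A} (t : T ⟶ Y) (ht : t ≫ p = 0) :
    ∃ l : T ⟶ X, l ≫ i = t := by
  obtain ⟨hl⟩ := E.isKernel _ h
  obtain ⟨l, hl⟩ := KernelFork.IsLimit.lift' hl t ht
  exact ⟨l, hl⟩

lemma exists_desc {X Y Z : A} {i : X ⟶ Y} {p : Y ⟶ Z} {w : i ≫ p = 0}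
    (h : E.exact (ShortComplex.mk i p w)) {T : A} (t : Y ⟶ T) (ht : i ≫ t = 0) :
    ∃ l : Z ⟶ T, p ≫ l = t := by
  obtain ⟨hl⟩ := E.isCokernel _ h
  obtain ⟨l, hl⟩ := CokernelCofork.IsColimit.desc' hl t ht
  exact ⟨l, hl⟩

lemma mono_of_exact {X Y Z : A} {i : X ⟶ Y} {p : Y ⟶ Z} {w : i ≫ p = 0}
    (h : E.exact (ShortComplex.mk i p w)) : Mono i := by
  obtain ⟨hl⟩ := E.isKernel _ h
  exact mono_of_isLimit_fork hl

lemma epi_of_exact {X Y Z : A} {i : X ⟶ Y} {p : Y ⟶ Z} {w : i ≫ p = 0}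
    (h : E.exact (ShortComplex.mk i p w)) : Epi p := by
  obtain ⟨hl⟩ := E.isCokernel _ h
  exact epi_of_isColimit_cofork hl

/-- A kernel of an admissible epimorphism completes it to an exact sequence. -/
lemma exact_of_kernel {X Y Z : A} {i : X ⟶ Y} {p : Y ⟶ Z} (w : i ≫ p = 0)
    (hp : IsAdmissibleEpi E.exact p) [Mono i]
    (hi : ∀ {T : A} (t : T ⟶ Y), t ≫ p = 0 → ∃ l : T ⟶ X, l ≫ i = t) :
    E.exact (ShortComplex.mk i p w) := by
  obtain ⟨K, k, wk, h⟩ := hp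
  have := mono_of_exact h
  obtain ⟨a, ha⟩ := exists_lift h i w
  obtain ⟨b, hb⟩ := hi k wk
  refine E.exact_of_iso (ShortComplex.isoMk (S₁ := .mk k p wk) (S₂ := .mk i p w)
    ⟨b, a, ?_, ?_⟩ (Iso.refl _) (Iso.refl _) (by simp [hb]) (by simp)) h
  · rw [← cancel_mono k, assoc, ha, hb, id_comp]
  · rw [← cancel_mono i, assoc, hb, ha, id_comp]

/-- A cokernel of an admissible monomorphism completes it to an exact sequence. -/
lemma exact_of_cokernel {X Y Z : A} {i : X ⟶ Y} {p : Y ⟶ Z} (w : i ≫ p = 0)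
    (hi : IsAdmissibleMono E.exact i) [Epi p]
    (hp : ∀ {T : A} (t : Y ⟶ T), i ≫ t = 0 → ∃ l : Z ⟶ T, p ≫ l = t) :
    E.exact (ShortComplex.mk i p w) := by
  obtain ⟨K, k, wk, h⟩ := hi
  have := epi_of_exact h
  obtain ⟨a, ha⟩ := exists_desc h p w
  obtain ⟨b, hb⟩ := hp k wk
  refine E.exact_of_iso (ShortComplex.isoMk (S₁ := .mk i k wk) (S₂ := .mk i p w)
    (Iso.refl _) (Iso.refl _) ⟨a, b, ?_, ?_⟩ (by simp) (by simp [ha])) h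
  · rw [← cancel_epi k, reassoc_of% ha, hb, comp_id]
  · rw [← cancel_epi p, reassoc_of% hb, ha, comp_id]

lemma admissibleMono_of_iso {X Y X' Y' : A} {i : X ⟶ Y} (hi : IsAdmissibleMono E.exact i)
    {i' : X' ⟶ Y'} (e : X ≅ X') (e' : Y ≅ Y') (h : i ≫ e'.hom = e.hom ≫ i') :
    IsAdmissibleMono E.exact i' := by
  obtain ⟨Z, p, w, hE⟩ := hi
  have h' : i' = e.inv ≫ i ≫ e'.hom := by rw [h, e.inv_hom_id_assoc]
  exact ⟨Z, e'.inv ≫ p, by simp [h', w], E.exact_of_iso (ShortComplex.isoMk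
    (S₁ := .mk i p w) (S₂ := .mk i' (e'.inv ≫ p) (by simp [h', w])) e e' (Iso.refl _)
    h.symm (by simp)) hE⟩

lemma admissibleEpi_of_iso {X Y X' Y' : A} {i : X ⟶ Y} (hi : IsAdmissibleEpi E.exact i)
    {i' : X' ⟶ Y'} (e : X ≅ X') (e' : Y ≅ Y') (h : i ≫ e'.hom = e.hom ≫ i') :
    IsAdmissibleEpi E.exact i' := by
  obtain ⟨Z, p, w, hE⟩ := hi
  have h' : i' = e.inv ≫ i ≫ e'.hom := by rw [h, e.inv_hom_id_assoc]
  exact ⟨Z, p ≫ e.hom, by simp [h', reassoc_of% w], E.exact_of_iso (ShortComplex.isoMk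
    (S₁ := .mk p i w) (S₂ := .mk (p ≫ e.hom) i' (by simp [h', reassoc_of% w]))
    (Iso.refl _) e e' (by simp) h.symm) hE⟩

lemma admissibleMono_of_isPushout {X Y X' Y' : A} {i : X ⟶ Y} {f : X ⟶ X'} {f' : Y ⟶ Y'}
    {i' : X' ⟶ Y'} (sq : IsPushout i f f' i') (hi : IsAdmissibleMono E.exact i) :
    IsAdmissibleMono E.exact i' := by
  obtain ⟨Z, g, j, sq', hj⟩ := E.pushout i f hi
  exact admissibleMono_of_iso hj (Iso.refl _) (sq'.isoIsPushout _ _ sq) (by simp)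

lemma admissibleEpi_of_isPullback {Y Z Y' Z' : A} {p : Y ⟶ Z} {f : Z' ⟶ Z} {f' : Y' ⟶ Y}
    {p' : Y' ⟶ Z'} (sq : IsPullback f' p' p f) (hp : IsAdmissibleEpi E.exact p) :
    IsAdmissibleEpi E.exact p' := by
  obtain ⟨Z, g, j, sq', hj⟩ := E.pullback p f hp
  exact admissibleEpi_of_iso hj (sq'.isoIsPullback _ _ sq) (Iso.refl _) (by simp)

/-- Special case of the short five lemma: in a morphism of exact sequences, the pushout of the
first is the pullback of the second one. -/
lemma isPullback_of_isPushout {X Y Z X' Y' Z' Q : A} {i : X ⟶ Y} {p : Y ⟶ Z} {w : i ≫ p = 0}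
    (h : E.exact (ShortComplex.mk i p w)) {i' : X' ⟶ Y'} {p' : Y' ⟶ Z'} {w' : i' ≫ p' = 0}
    (h' : E.exact (ShortComplex.mk i' p' w')) {a : X ⟶ X'} {b : Y ⟶ Y'} {c : Z ⟶ Z'}
    (hab : i ≫ b = a ≫ i') (hbc : p ≫ c = b ≫ p') {j : Y ⟶ Q} {j' : X' ⟶ Q}
    (sq : IsPushout i a j j') :
    IsPullback (sq.desc b i' hab) (sq.desc p 0 (by simp [w])) p' c := by
  have hj' : IsAdmissibleMono E.exact j' := admissibleMono_of_isPushout sq ⟨_, _, _, h⟩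
  set q : Q ⟶ Z := sq.desc p 0 (by simp [w])
  set r : Q ⟶ Y' := sq.desc b i' hab
  have hjq : j ≫ q = p := by simp [q]
  have hj'q : j' ≫ q = 0 := by simp [q]
  have hjr : j ≫ r = b := by simp [r]
  have hj'r : j' ≫ r = i' := by simp [r]
  have := epi_of_exact h
  have := mono_of_exact h'
  have : Epi q := ⟨fun x y hxy ↦ by
    rw [← cancel_epi p, ← hjq, assoc, hxy, assoc]⟩
  have hQ : E.exact (ShortComplex.mk j' q hj'q) := exact_of_cokernel _ hj' (fun t ht ↦ by
    obtain ⟨l, hl⟩ := exists_desc h (j ≫ t) (by rw [sq.w_assoc, ht, comp_zero])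
    refine ⟨l, sq.hom_ext (by rw [reassoc_of% hjq, hl]) (by rw [reassoc_of% hj'q, zero_comp, ht])⟩)
  have hrq : r ≫ p' = q ≫ c := sq.hom_ext (by rw [reassoc_of% hjr, reassoc_of% hjq, hbc])
    (by rw [reassoc_of% hj'r, reassoc_of% hj'q, w', zero_comp])
  obtain ⟨P, f, g, sqP, hg⟩ := E.pullback p' c ⟨_, _, _, h'⟩
  obtain ⟨T, s, e, sqT, he⟩ := E.pullback q g ⟨_, _, _, hQ⟩
  obtain ⟨K, k, wk, hk⟩ := he
  let φ : Q ⟶ P := sqP.lift r q hrq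
  have hφf : φ ≫ f = r := by simp [φ]
  have hφg : φ ≫ g = q := by simp [φ]
  have := mono_of_exact hQ
  have hmono : Mono φ := by
    rw [Preadditive.mono_iff_cancel_zero]
    intro W x hx
    obtain ⟨y, rfl⟩ := exists_lift hQ x (by rw [← hφg, reassoc_of% hx, zero_comp])
    have : y = 0 := by
      rw [← cancel_mono i', zero_comp, ← hj'r, ← hφf, ← assoc, ← assoc, hx, zero_comp]
    rw [this, zero_comp]
  obtain ⟨ρ, hρ⟩ := exists_lift h' ((e - s ≫ φ) ≫ f) (by
    rw [assoc, sqP.w, Preadditive.sub_comp_assoc, assoc, hφg, sqT.w, sub_self, zero_comp])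
  have hρ' : ρ ≫ j' ≫ φ = e - s ≫ φ := sqP.hom_ext (by
      rw [assoc, assoc, hφf, hj'r, hρ]) (by
      rw [assoc, assoc, hφg, hj'q, Preadditive.sub_comp, assoc, hφg, sqT.w, sub_self, comp_zero])
  obtain ⟨ψ, hψ⟩ := exists_desc hk (s + ρ ≫ j') (by
    rw [← cancel_mono φ, zero_comp, assoc, Preadditive.add_comp, assoc, hρ', add_sub_cancel, wk])
  have := epi_of_exact hk
  have hψφ : ψ ≫ φ = 𝟙 _ := by
    rw [← cancel_epi e, reassoc_of% hψ, Preadditive.add_comp, assoc, hρ', add_sub_cancel, comp_id]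
  let ε : P ≅ Q := ⟨ψ, φ, hψφ, by rw [← cancel_mono φ, assoc, hψφ, comp_id, id_comp]⟩
  exact IsPullback.of_iso sqP ε (Iso.refl _) (Iso.refl _) (Iso.refl _)
    (by rw [Iso.refl_hom, comp_id, ← hφf, ← assoc]; exact by simp [ε, hψφ])
    (by rw [Iso.refl_hom, comp_id, ← hφg, ← assoc]; exact by simp [ε, hψφ]) (by simp) (by simp)

variable [HasBinaryBiproducts A]

lemma admissibleMono_biprod_inl (X Y : A) :
    IsAdmissibleMono E.exact (biprod.inl : X ⟶ X ⊞ Y) := by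
  obtain ⟨K, i, w, h⟩ := E.epi_id Y
  have hi : i = 0 := by simpa using w
  subst hi
  have := mono_of_exact h
  have hK : IsZero K := by
    rw [IsZero.iff_id_eq_zero, ← cancel_mono (0 : K ⟶ Y)]; simp
  refine admissibleMono_of_isPushout (i := (0 : K ⟶ Y)) (f := (0 : K ⟶ X))
    (f' := biprod.inr) ⟨⟨by simp⟩, ⟨PushoutCocone.IsColimit.mk _
      (fun s ↦ biprod.desc s.inr s.inl) (by simp) (by simp) ?_⟩⟩ ⟨_, _, _, h⟩
  intro s m h₁ h₂
  ext <;> simp [h₁, h₂]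

/-- A pushout square along an admissible monomorphism gives an exact sequence. -/
lemma exact_of_isPushout {X Y X' Y' : A} {i : X ⟶ Y} {f : X ⟶ X'} {f' : Y ⟶ Y'}
    {i' : X' ⟶ Y'} (sq : IsPushout i f f' i') (hi : IsAdmissibleMono E.exact i) :
    E.exact (ShortComplex.mk (biprod.lift (-i) f) (biprod.desc f' i') (by simp [sq.w])) := by
  have hi₁ : IsAdmissibleMono E.exact (biprod.map i (𝟙 X')) :=
    admissibleMono_of_isPushout (i := i) (f := biprod.inl) (f' := biprod.inl)
      ⟨⟨by simp⟩, ⟨PushoutCocone.IsColimit.mk _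
        (fun s ↦ biprod.desc s.inl (biprod.inr ≫ s.inr)) (by simp) (by
          intro s
          ext
          · simpa using s.condition
          · simp) (by
          intro s m h₁ h₂
          ext
          · simp [h₁]
          · simp [← h₂])⟩⟩ hi
  let e : Y ⊞ X' ≅ Y ⊞ X' :=
    { hom := biprod.desc (-biprod.inl) biprod.inr
      inv := biprod.desc (-biprod.inl) biprod.inr }
  let e' : X ⊞ X' ≅ X ⊞ X' :=
    { hom := biprod.desc (biprod.lift (𝟙 X) f) biprod.inr
      inv := biprod.desc (biprod.lift (𝟙 X) (-f)) biprod.inr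
      hom_inv_id := by ext <;> simp
      inv_hom_id := by ext <;> simp }
  have hi₃ : IsAdmissibleMono E.exact (biprod.lift (-i) f) := by
    have h₁ : IsAdmissibleMono E.exact (biprod.lift (𝟙 X) f) :=
      admissibleMono_of_iso (admissibleMono_biprod_inl X X') (Iso.refl _) e' (by simp [e'])
    refine admissibleMono_of_iso (E.mono_comp _ _ h₁ hi₁) (Iso.refl _) e ?_
    have : biprod.lift (𝟙 X) f ≫ biprod.map i (𝟙 X') = biprod.lift i f := by ext <;> simp
    rw [this]
    ext <;> simp [e]
  have : Epi (biprod.desc f' i') := ⟨fun a b h ↦ sq.hom_ext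
    (by simpa using congrArg (biprod.inl ≫ ·) h) (by simpa using congrArg (biprod.inr ≫ ·) h)⟩
  refine exact_of_cokernel _ hi₃ (fun t ht ↦ ?_)
  have ht' : i ≫ biprod.inl ≫ t = f ≫ biprod.inr ≫ t := by
    rw [biprod.lift_eq, Preadditive.add_comp, assoc, assoc, Preadditive.neg_comp] at ht
    exact (neg_add_eq_zero.1 ht)
  exact ⟨sq.desc (biprod.inl ≫ t) (biprod.inr ≫ t) ht', by ext <;> simp⟩

/-- The exact sequence formed by the cycles of a mapping cone. -/
lemma exact_cone {X Y Z X' Y' Z' W Q Q' : A} {i : X ⟶ Y} {p : Y ⟶ Z} {w : i ≫ p = 0}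
    (h : E.exact (ShortComplex.mk i p w)) {i' : X' ⟶ Y'} {p' : Y' ⟶ Z'} {w' : i' ≫ p' = 0}
    (h' : E.exact (ShortComplex.mk i' p' w')) {a : X ⟶ X'} {b : Y ⟶ Y'} {c : Z ⟶ Z'}
    (hab : i ≫ b = a ≫ i') (hbc : p ≫ c = b ≫ p') {j : Y ⟶ Q} {j' : X' ⟶ Q}
    (sq : IsPushout i a j j') {m : Z ⟶ W} (hm : IsAdmissibleMono E.exact m)
    {l : W ⟶ Q'} {l' : Z' ⟶ Q'} (sq' : IsPushout m c l l') :
    E.exact (ShortComplex.mk (X₂ := W ⊞ Y')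
      (biprod.lift (sq.desc (-(p ≫ m)) 0 (by simp [reassoc_of% w])) (sq.desc b i' hab))
      (biprod.desc l (p' ≫ l'))
      (sq.hom_ext (by simp [sq'.w, reassoc_of% hbc]) (by simp [reassoc_of% w']))) := by
  have sqP := isPullback_of_isPushout h h' hab hbc sq
  have hS := exact_of_isPushout sq' hm
  have hq : sq.desc (-(p ≫ m)) 0 (by simp [reassoc_of% w]) = -sq.desc p 0 (by simp [w]) ≫ m :=
    sq.hom_ext (by simp) (by simp)
  have hv : (biprod.desc l (p' ≫ l') : W ⊞ Y' ⟶ Q') =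
    biprod.map (𝟙 W) p' ≫ biprod.desc l l' := by ext <;> simp
  have hadm : IsAdmissibleEpi E.exact (biprod.desc l (p' ≫ l') : W ⊞ Y' ⟶ Q') := by
    rw [hv]
    refine E.epi_comp _ _ ?_ ⟨_, _, _, hS⟩
    refine admissibleEpi_of_isPullback (p := p') (f := biprod.snd) (f' := biprod.snd)
      ⟨⟨by simp⟩, ⟨PullbackCone.IsLimit.mk _
        (fun s ↦ biprod.lift (s.snd ≫ biprod.fst) s.fst) (by simp) (by
          intro s
          ext
          · simp
          · simpa using s.condition) (by
          intro s t h₁ h₂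
          ext
          · simp [← h₂]
          · simp [h₁])⟩⟩ ⟨_, _, _, h'⟩
  have hmm : Mono m := by
    obtain ⟨_, _, _, H⟩ := hm
    exact mono_of_exact H
  have hmono : Mono (biprod.lift (sq.desc (-(p ≫ m)) 0 (by simp [reassoc_of% w]))
      (sq.desc b i' hab)) := ⟨fun x y hxy ↦ by
    refine sqP.hom_ext (by simpa using congrArg (· ≫ biprod.snd) hxy) ?_
    have := congrArg (· ≫ biprod.fst) hxy
    rw [hq] at this
    rw [← cancel_mono m]
    simpa using this⟩
  refine exact_of_kernel _ hadm (fun {T} t ht ↦ ?_)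
  obtain ⟨z, hz⟩ := exists_lift hS (t ≫ biprod.map (𝟙 W) p') (by rw [assoc, ← hv, ht])
  have h₁ : -(z ≫ m) = t ≫ biprod.fst := by simpa using congrArg (· ≫ biprod.fst) hz
  have h₂ : z ≫ c = t ≫ biprod.snd ≫ p' := by simpa using congrArg (· ≫ biprod.snd) hz
  refine ⟨sqP.lift (t ≫ biprod.snd) z (by rw [h₂, assoc]), ?_⟩
  ext
  · simp [hq, h₁]
  · simp

end Basic

/-- A cochain complex is acyclic for the exact structure if its differentials factor as
`K.X n ⟶ Z (n + 1) ⟶ K.X (n + 1)` with all `0 ⟶ Z n ⟶ K.X n ⟶ Z (n + 1) ⟶ 0` exact. -/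
def IsAcyclic (K : CochainComplex A ℤ) : Prop :=
  ∃ (Z : ℤ → A) (i : ∀ n, Z n ⟶ K.X n) (p : ∀ n m, n + 1 = m → (K.X n ⟶ Z m))
    (w : ∀ n m h, i n ≫ p n m h = 0),
    (∀ n m h, E.exact (ShortComplex.mk (i n) (p n m h) (w n m h))) ∧
    ∀ n m h, p n m h ≫ i m = K.d n m

variable {E} in
lemma IsAcyclic.shift {K : CochainComplex A ℤ} (hK : E.IsAcyclic K) (a : ℤ) :
    E.IsAcyclic (K⟦a⟧) := by
  obtain ⟨Z, i, p, w, hE, hd⟩ := hK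
  have w₁ (n m : ℤ) (h : n + 1 = m) : (a.negOnePow • i n) ≫ p n m h = 0 := by
    rw [Linear.units_smul_comp, w, smul_zero]
  have hE₁ (n m : ℤ) (h : n + 1 = m) : E.exact (ShortComplex.mk _ _ (w₁ n m h)) :=
    E.exact_of_iso (ShortComplex.isoMk (S₁ := .mk _ _ (w n m h)) (S₂ := .mk _ _ (w₁ n m h))
      (a.negOnePow • Iso.refl _) (Iso.refl _) (Iso.refl _) (by simp [smul_smul]) (by simp))
      (hE _ _ _)
  have hd₁ (n m : ℤ) (h : n + 1 = m) : p n m h ≫ (a.negOnePow • i m) = a.negOnePow • K.d n m := by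
    rw [Linear.comp_units_smul, hd]
  exact ⟨fun n ↦ Z (n + a), fun n ↦ a.negOnePow • i (n + a),
    fun n m h ↦ p (n + a) (m + a) (by lia), fun n m h ↦ w₁ _ _ _, fun n m h ↦ hE₁ _ _ _,
    fun n m h ↦ hd₁ _ _ _⟩

variable {E} in
/-- The mapping cone of a morphism of acyclic complexes is acyclic. -/
lemma IsAcyclic.mappingCone [HasBinaryBiproducts A] {K L : CochainComplex A ℤ} (hK : E.IsAcyclic K) (hL : E.IsAcyclic L)
    (f : K ⟶ L) : E.IsAcyclic (CochainComplex.mappingCone f) := by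
  obtain ⟨Z, i, p, w, hE, hd⟩ := hK
  obtain ⟨Z', i', p', w', hE', hd'⟩ := hL
  have hi' (n : ℤ) : Mono (i' n) := mono_of_exact (hE' n _ rfl)
  have hg (n : ℤ) : ∃ g : Z n ⟶ Z' n, g ≫ i' n = i n ≫ f.f n := by
    refine exists_lift (hE' n _ rfl) _ ?_
    rw [← cancel_mono (i' (n + 1)), assoc, hd', assoc, f.comm, ← hd _ _ rfl,
      assoc, reassoc_of% (w n _ rfl), zero_comp, zero_comp]
  choose g hg using hg
  have hpg (n m : ℤ) (h : n + 1 = m) : p n m h ≫ g m = f.f n ≫ p' n m h := by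
    rw [← cancel_mono (i' m), assoc, hg, ← assoc, hd, assoc, hd', f.comm]
  have hm (n : ℤ) : IsAdmissibleMono E.exact (i n) := ⟨_, _, _, hE n _ rfl⟩
  choose Q j j' sq _ using fun n ↦ E.pushout (i n) (g n) (hm n)
  have hex (n m : ℤ) (h : n + 1 = m) := exact_cone (hE n m h) (hE' n m h) (hg n).symm (hpg n m h)
    (sq n) (hm m) (sq m)
  obtain ⟨e, he⟩ : ∃ e : ∀ (n m : ℤ) (_ : n + 1 = m),
      K.X m ⊞ L.X n ≅ (CochainComplex.mappingCone f).X n, ∀ (n m : ℤ) (h : n + 1 = m),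
      (e n m h).hom = biprod.desc ((CochainComplex.mappingCone.inl f).v m n (by lia))
        ((CochainComplex.mappingCone.inr f).f n) :=
    ⟨fun n m h ↦
      { hom := biprod.desc ((CochainComplex.mappingCone.inl f).v m n (by lia))
          ((CochainComplex.mappingCone.inr f).f n)
        inv := biprod.lift ((CochainComplex.mappingCone.fst f).1.v n m h)
          ((CochainComplex.mappingCone.snd f).v n n (add_zero n))
        hom_inv_id := by ext <;> simp
        inv_hom_id := by simp [CochainComplex.mappingCone.id_X] }, fun _ _ _ ↦ rfl⟩
  let u (n m : ℤ) (h : n + 1 = m) : Q n ⟶ K.X m ⊞ L.X n :=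
    biprod.lift ((sq n).desc (-(p n m h ≫ i m)) 0 (by simp [reassoc_of% (w n m h)]))
      ((sq n).desc (f.f n) (i' n) (hg n).symm)
  let v (n m : ℤ) (h : n + 1 = m) : K.X m ⊞ L.X n ⟶ Q m := biprod.desc (j m) (p' n m h ≫ j' m)
  have huv (n m : ℤ) (h : n + 1 = m) : u n m h ≫ v n m h = 0 :=
    (sq n).hom_ext (by simp [u, v, (sq m).w, reassoc_of% (hpg n m h)])
      (by simp [u, v, reassoc_of% (w' n m h)])
  have huv' (n m : ℤ) (h : n + 1 = m) :
      (u n m h ≫ (e n m h).hom) ≫ (e n m h).inv ≫ v n m h = 0 := by simp [huv]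
  refine ⟨Q, fun n ↦ u n (n + 1) rfl ≫ (e n (n + 1) rfl).hom, fun n m h ↦ (e n m h).inv ≫ v n m h,
    fun n m h ↦ by subst h; exact huv' _ _ _, fun n m h ↦ ?_, fun n m h ↦ ?_⟩
  · subst h
    exact E.exact_of_iso (ShortComplex.isoMk (S₁ := .mk _ _ (huv n _ rfl))
      (S₂ := .mk _ _ (huv' n _ rfl)) (Iso.refl _) (e n _ rfl) (Iso.refl _)
      (by simp) (by simp)) (hex n _ rfl)
  · rw [← cancel_epi (e n m h).hom, assoc, Iso.hom_inv_id_assoc]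
    simp only [he, u, v]
    ext
    · rw [biprod.inl_desc_assoc, biprod.inl_desc_assoc,
        CochainComplex.mappingCone.inl_v_d f m n (m + 1) (by lia) (by lia), ← hd _ _ rfl]
      simp [biprod.lift_desc, neg_add_eq_sub]
    · rw [biprod.inr_desc_assoc, biprod.inr_desc_assoc, CochainComplex.mappingCone.inr_f_d,
        ← hd' _ _ h]
      simp [biprod.lift_desc]

lemma isAcyclic_zero [HasZeroObject A] : E.IsAcyclic (0 : CochainComplex A ℤ) := by
  obtain ⟨K, k, w, h⟩ := E.epi_id (0 : A)
  have hz (n : ℤ) : IsZero ((0 : CochainComplex A ℤ).X n) :=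
    Functor.map_isZero (HomologicalComplex.eval A _ n) (isZero_zero _)
  have hK : IsZero K := by
    have := mono_of_exact h
    rw [IsZero.iff_id_eq_zero, ← cancel_mono k]
    exact (isZero_zero A).eq_of_tgt _ _
  refine ⟨fun _ ↦ 0, fun _ ↦ 0, fun _ _ _ ↦ 0, fun _ _ _ ↦ by simp, fun n m _ ↦
    E.exact_of_iso (ShortComplex.isoMk (hK.iso (isZero_zero _))
      ((isZero_zero _).iso (hz n)) ((isZero_zero _).iso (isZero_zero _)) ?_ ?_) h,
    fun n m _ ↦ (hz n).eq_of_src _ _⟩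
  · exact hK.eq_of_src _ _
  · exact (isZero_zero A).eq_of_src _ _

end ExactStructure

section Bounded

variable (A : Type u) [Category.{v} A] [Preadditive A]

/-- The objects of the homotopy category of cochain complexes which are bounded complexes. -/
def boundedComplexes : ObjectProperty (HomotopyCategory A (ComplexShape.up ℤ)) :=
  fun K ↦ ∃ a b : ℤ, CochainComplex.IsStrictlyGE K.as a ∧ CochainComplex.IsStrictlyLE K.as b

instance : (boundedComplexes A).IsStableUnderShift ℤ where
  isStableUnderShiftBy n :=
    { le_shift := by
        intro K ⟨a, b, ha, hb⟩
        obtain ⟨K : CochainComplex _ _, rfl⟩ := K.quotient_obj_surjective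
        change CochainComplex.IsStrictlyGE K a at ha
        change CochainComplex.IsStrictlyLE K b at hb
        rw [ObjectProperty.prop_shift_iff, HomotopyCategory.shift_quotient_obj]
        exact ⟨a - n, b - n, CochainComplex.isStrictlyGE_shift K a n (a - n) (by lia),
          CochainComplex.isStrictlyLE_shift K b n (b - n) (by lia)⟩ }

variable {A} in
lemma boundedComplexes_mappingCone [HasBinaryBiproducts A] {K L : CochainComplex A ℤ} (f : K ⟶ L)
    (hK : boundedComplexes A ((HomotopyCategory.quotient _ _).obj K))
    (hL : boundedComplexes A ((HomotopyCategory.quotient _ _).obj L)) :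
    boundedComplexes A ((HomotopyCategory.quotient _ _).obj (CochainComplex.mappingCone f)) := by
  obtain ⟨a, b, ha, hb⟩ := hK
  obtain ⟨a', b', ha', hb'⟩ := hL
  change CochainComplex.IsStrictlyGE K a at ha
  change CochainComplex.IsStrictlyLE K b at hb
  change CochainComplex.IsStrictlyGE L a' at ha'
  change CochainComplex.IsStrictlyLE L b' at hb'
  refine ⟨min (a - 1) a', max b b', CochainComplex.isStrictlyGE_mappingCone f a a' _
    (by simp) (by simp), ?_⟩
  refine (CochainComplex.isStrictlyLE_iff (CochainComplex.mappingCone f) _).2 (fun i hi ↦ ?_)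
  simp only [sup_lt_iff] at hi
  rw [CochainComplex.mappingCone.isZero_X_iff]
  exact ⟨K.isZero_of_isStrictlyLE b _ (by lia), L.isZero_of_isStrictlyLE b' _ (by lia)⟩

variable {A} in
/-- In the homotopy category, the third object of a distinguished triangle is a mapping cone. -/
lemma exists_iso_mappingCone [HasZeroObject A] [HasBinaryBiproducts A]
    (T : Triangle (HomotopyCategory A (ComplexShape.up ℤ))) (hT : T ∈ distTriang _) :
    ∃ f : T.obj₁.as ⟶ T.obj₂.as, Nonempty
      (T.obj₃ ≅ (HomotopyCategory.quotient _ _).obj (CochainComplex.mappingCone f)) := by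
  obtain ⟨f, hf⟩ := (HomotopyCategory.quotient A (ComplexShape.up ℤ)).map_surjective
    (X := T.obj₁.as) (Y := T.obj₂.as) T.mor₁
  obtain ⟨e, -⟩ := exists_iso_of_arrow_iso T _ hT
    (HomotopyCategory.mappingCone_triangleh_distinguished f)
    (Arrow.isoMk (f := Arrow.mk T.mor₁)
      (g := Arrow.mk ((HomotopyCategory.quotient A (ComplexShape.up ℤ)).map f))
      (Iso.refl _) (Iso.refl _)
      ((Category.id_comp _).trans (hf.trans (Category.comp_id _).symm)))
  exact ⟨f, ⟨Triangle.π₃.mapIso e⟩⟩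

/-- The bounded homotopy category `K^b(A)`. -/
abbrev BoundedHomotopyCategory := (boundedComplexes A).FullSubcategory

instance [HasZeroObject A] [HasBinaryBiproducts A] : (boundedComplexes A).IsTriangulated where
  exists_zero := ⟨(HomotopyCategory.quotient _ _).obj 0, Functor.map_isZero _ (isZero_zero _),
    0, 0, inferInstanceAs (CochainComplex.IsStrictlyGE (0 : CochainComplex A ℤ) 0),
    inferInstanceAs (CochainComplex.IsStrictlyLE (0 : CochainComplex A ℤ) 0)⟩
  toIsTriangulatedClosed₂ :=
    have : (boundedComplexes A).IsTriangulatedClosed₃ := ⟨fun T hT h₁ h₂ ↦ by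
      obtain ⟨f, ⟨e⟩⟩ := exists_iso_mappingCone T hT
      exact ⟨_, boundedComplexes_mappingCone f h₁ h₂, ⟨e⟩⟩⟩
    .of_isTriangulatedClosed₃

end Bounded

namespace ExactStructure

variable {A : Type u} [Category.{v} A] [Preadditive A] [HasZeroObject A] [HasBinaryBiproducts A]
  (E : ExactStructure A)

/-- The objects of `K^b(A)` which are acyclic, i.e. isomorphic in `K^b(A)` to a bounded acyclic
complex. (If `A` is idempotent complete, such a complex is itself acyclic.) -/
def acyclic {A : Type u} [Category.{v} A] [Preadditive A] (E : ExactStructure A) :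
    ObjectProperty (BoundedHomotopyCategory A) :=
  ObjectProperty.isoClosure (fun K ↦ E.IsAcyclic K.obj.as)

instance : E.acyclic.IsClosedUnderIsomorphisms :=
  inferInstanceAs (ObjectProperty.isoClosure _).IsClosedUnderIsomorphisms

lemma acyclic_of_iso {A : Type u} [Category.{v} A] [Preadditive A] (E : ExactStructure A)
    {K : CochainComplex A ℤ} (hK : E.IsAcyclic K)
    (hK' : boundedComplexes A ((HomotopyCategory.quotient _ _).obj K))
    {L : BoundedHomotopyCategory A} (e : L.obj ≅ (HomotopyCategory.quotient _ _).obj K) :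
    E.acyclic L :=
  ⟨⟨_, hK'⟩, hK, ⟨(boundedComplexes A).ι.preimageIso e⟩⟩

instance : E.acyclic.IsStableUnderShift ℤ where
  isStableUnderShiftBy n :=
    { le_shift := by
        intro K ⟨⟨L, hL⟩, hL', ⟨e⟩⟩
        have hs := (boundedComplexes A).le_shift n _ hL
        obtain ⟨L : CochainComplex _ _, rfl⟩ := L.quotient_obj_surjective
        rw [ObjectProperty.prop_shift_iff, HomotopyCategory.shift_quotient_obj] at hs
        exact E.acyclic_of_iso (IsAcyclic.shift hL' n) hs
          (((boundedComplexes A).ι.commShiftIso n).app K ≪≫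
            (shiftFunctor _ n).mapIso ((boundedComplexes A).ι.mapIso e) ≪≫
            (((HomotopyCategory.quotient A (ComplexShape.up ℤ)).commShiftIso n).app L).symm) }

/-- The acyclic complexes form a triangulated subcategory of `K^b(A)`. -/
instance : E.acyclic.IsTriangulated where
  exists_zero := by
    have h : boundedComplexes A ((HomotopyCategory.quotient _ _).obj 0) :=
      ⟨0, 0, inferInstanceAs (CochainComplex.IsStrictlyGE (0 : CochainComplex A ℤ) 0),
        inferInstanceAs (CochainComplex.IsStrictlyLE (0 : CochainComplex A ℤ) 0)⟩
    refine ⟨⟨_, h⟩, ?_, E.acyclic_of_iso E.isAcyclic_zero h (Iso.refl _)⟩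
    have : IsZero ((boundedComplexes A).ι.obj ⟨_, h⟩) :=
      Functor.map_isZero (HomotopyCategory.quotient _ _) (isZero_zero _)
    rw [IsZero.iff_id_eq_zero] at this ⊢
    exact (boundedComplexes A).ι.map_injective (by simpa using this)
  toIsTriangulatedClosed₂ :=
    have : E.acyclic.IsTriangulatedClosed₃ := .mk' (by
      rintro T hT ⟨K, hK, ⟨e⟩⟩ ⟨L, hL, ⟨e'⟩⟩
      let T' := Triangle.mk (e.inv ≫ T.mor₁ ≫ e'.hom) (e'.inv ≫ T.mor₂) (T.mor₃ ≫ e.hom⟦1⟧')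
      have h₁ : (e.inv ≫ T.mor₁ ≫ e'.hom) ≫ e'.inv = e.inv ≫ T.mor₁ := by simp
      have h₃ : (T.mor₃ ≫ e.hom⟦(1 : ℤ)⟧') ≫ e.inv⟦(1 : ℤ)⟧' = 𝟙 _ ≫ T.mor₃ := by
        rw [assoc, ← Functor.map_comp, e.hom_inv_id, CategoryTheory.Functor.map_id, comp_id, id_comp]
      have hT' : T' ∈ distTriang _ := isomorphic_distinguished _ hT _
        (Triangle.isoMk T' T e.symm e'.symm (Iso.refl _) h₁ (comp_id _) h₃)
      obtain ⟨f, ⟨e''⟩⟩ :=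
        exists_iso_mappingCone _ ((boundedComplexes A).ι.map_distinguished T' hT')
      exact E.acyclic_of_iso (IsAcyclic.mappingCone hK hL f)
        (boundedComplexes_mappingCone f K.property L.property) e'')
    .of_isTriangulatedClosed₃

/-- The bounded derived category `D^b(A)` of the exact category: the Verdier quotient of
`K^b(A)` by the acyclic complexes, i.e. its localization with respect to the morphisms
whose mapping cone is acyclic. -/
def BoundedDerivedCategory : Type (max u v) := E.acyclic.trW.Localization

noncomputable section

namespace BoundedDerivedCategory

instance : Category (BoundedDerivedCategory E) :=
  inferInstanceAs (Category E.acyclic.trW.Localization)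

/-- The quotient functor `K^b(A) ⥤ D^b(A)`. -/
def Qh : BoundedHomotopyCategory A ⥤ BoundedDerivedCategory E := E.acyclic.trW.Q

instance : (Qh E).IsLocalization E.acyclic.trW :=
  inferInstanceAs (E.acyclic.trW.Q.IsLocalization E.acyclic.trW)

instance : Preadditive (BoundedDerivedCategory E) := Localization.preadditive (Qh E) E.acyclic.trW

instance : (Qh E).Additive := Localization.functor_additive (Qh E) E.acyclic.trW

instance : HasZeroObject (BoundedDerivedCategory E) := (Qh E).hasZeroObject_of_additive

instance : HasShift (BoundedDerivedCategory E) ℤ := HasShift.localized (Qh E) E.acyclic.trW ℤ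

instance : (Qh E).CommShift ℤ := Functor.CommShift.localized (Qh E) E.acyclic.trW ℤ

instance (n : ℤ) : (shiftFunctor (BoundedDerivedCategory E) n).Additive := by
  rw [Localization.functor_additive_iff (Qh E) E.acyclic.trW]
  exact Functor.additive_of_iso ((Qh E).commShiftIso n)

instance : Pretriangulated (BoundedDerivedCategory E) :=
  Triangulated.Localization.pretriangulated (Qh E) E.acyclic.trW

instance : (Qh E).IsTriangulated :=
  Triangulated.Localization.isTriangulated_functor (Qh E) E.acyclic.trW

instance : IsTriangulated (BoundedDerivedCategory E) :=
  Triangulated.Localization.isTriangulated (Qh E) E.acyclic.trW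

/-- The functor `A ⥤ D^b(A)` sending an object to the complex concentrated in degree zero. -/
def single : A ⥤ BoundedDerivedCategory E :=
  (boundedComplexes A).lift
    (CochainComplex.singleFunctor A 0 ⋙ HomotopyCategory.quotient A (ComplexShape.up ℤ))
    (fun X ↦ ⟨0, 0,
      inferInstanceAs (CochainComplex.IsStrictlyGE ((CochainComplex.singleFunctor A 0).obj X) 0),
      inferInstanceAs (CochainComplex.IsStrictlyLE ((CochainComplex.singleFunctor A 0).obj X) 0)⟩) ⋙
    Qh E

end BoundedDerivedCategory

end

/-- A full subcategory of an exact category is thick if it is closed under direct factors and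
has the two out of three property for exact sequences. -/
structure IsThick {A : Type u} [Category.{v} A] [Preadditive A] (E : ExactStructure A)
    (C : ObjectProperty A) : Prop where
  retract : C.IsStableUnderRetracts
  left : ∀ S : ShortComplex A, E.exact S → C S.X₂ → C S.X₃ → C S.X₁
  middle : ∀ S : ShortComplex A, E.exact S → C S.X₁ → C S.X₃ → C S.X₂
  right : ∀ S : ShortComplex A, E.exact S → C S.X₁ → C S.X₂ → C S.X₃

/-- Cofinality: every admissible epimorphism `p : Y ⟶ Z` with `Z` in `C` admits an admissible
epimorphism `q : Y' ⟶ Z` with `Y'` in `C` factoring through `p`. -/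
def IsCofinal {A : Type u} [Category.{v} A] [Preadditive A] (E : ExactStructure A)
    (C : ObjectProperty A) : Prop :=
  ∀ {Y Z : A} (p : Y ⟶ Z), IsAdmissibleEpi E.exact p → C Z →
    ∃ (Y' : A) (q : Y' ⟶ Z), IsAdmissibleEpi E.exact q ∧ C Y' ∧ ∃ f : Y' ⟶ Y, f ≫ p = q

end ExactStructure

/-- A full subcategory of a triangulated category is thick if it is closed under shifts,
mapping cones and direct factors. -/
structure IsThickTriangulated {T : Type*} [Category* T] [Preadditive T] [HasZeroObject T]
    [HasShift T ℤ] [∀ n : ℤ, (shiftFunctor T n).Additive] [Pretriangulated T]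
    (D : ObjectProperty T) : Prop where
  shift : D.IsStableUnderShift ℤ
  cone : D.IsTriangulatedClosed₃
  retract : D.IsStableUnderRetracts

/-! The converse direction rests on one fact: an exact sequence in `A` becomes a distinguished
triangle in `D^b(A)`, because the cone of `cone(X ⟶ Y) ⟶ Z` is the acyclic complex `X ⟶ Y ⟶ Z`
(`exists_distinguished_single`). Two out of three for `D` then gives two out of three for `C`, and
direct factors are preserved by any functor.

For the direct part, let `P` be the triangulated subcategory of `K^b(A)` generated by `C`. The
candidate `D` is the closure under retracts of the image of `P` in `D^b(A)`. The difficulty is to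
see that this adds no new objects of `A`.

Cofinality enters through `IsCofinal.exists_fac`: a morphism from an object of `C` to an acyclic
complex factors through an acyclic object of `P`. This property passes from `C` to all of `P` by
extensions (`exists_fac_of_distinguished`). Consequently every morphism in `D^b(A)` out of an object
of `P` is a right fraction whose middle object lies in `P`, and the image of `P` is triangulated
(`isTriangulated_map_of_isVerdierLeftLocalizing`).

Suppose now that `X` in `A` is a retract of an object of that image. Then `X` itself need not
obviously come from `P`, but `X⟦1⟧ ⊞ X` does, being the cone of an idempotent
(`shift_biprod_of_retract`). Lifting this isomorphism to a fraction yields a bounded complex `K'`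
with terms in `C` and a morphism `K' ⟶ X⟦1⟧ ⊞ X` with acyclic cone. Starting from the left, where
everything vanishes, the cycles of the cone lie in `C` up to degree `-1`, and `X` is a direct factor
of the cycles in that degree (`IsThick.prop_of_isAcyclic_mappingCone`).

Idempotent completeness makes acyclicity invariant under retracts up to homotopy
(`IsAcyclic.of_homotopy`), so that morphisms inverted in `D^b(A)` have genuinely acyclic cones. -/

namespace ExactStructure

/-! ### Acyclic complexes over an idempotent complete exact category -/

section Retracts

variable {A : Type u} [Category.{v} A] [Preadditive A] {E : ExactStructure A}

/-- Quillen's obscure axiom: if `i ≫ j` is an admissible monomorphism and `i` has a cokernel,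
then `i` is an admissible monomorphism. -/
lemma exact_of_admissibleMono_comp [HasBinaryBiproducts A] {X Y Z W : A} {i : X ⟶ Y} {j : Y ⟶ W}
    {k : Y ⟶ Z} (w : i ≫ k = 0) (hij : IsAdmissibleMono E.exact (i ≫ j)) [Epi k]
    (hk : ∀ {T : A} (t : Y ⟶ T), i ≫ t = 0 → ∃ l : Z ⟶ T, k ≫ l = t) :
    E.exact (ShortComplex.mk i k w) := by
  obtain ⟨P, f', i', sq, hi'⟩ := E.pushout (i ≫ j) i hij
  have h₁ : IsAdmissibleMono E.exact (biprod.lift (-(i ≫ j)) i) := ⟨_, _, _, exact_of_isPushout sq hij⟩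
  -- A shear: adding `j` of the second coordinate to the first cancels `-(i ≫ j)`, leaving `(0, i)`,
  -- whose cokernel is visibly `𝟙 W ⊞ k`. Then `k` is a pullback of that admissible epimorphism.
  let e : W ⊞ Y ≅ W ⊞ Y :=
    { hom := biprod.desc biprod.inl (biprod.lift j (𝟙 Y))
      inv := biprod.desc biprod.inl (biprod.lift (-j) (𝟙 Y))
      hom_inv_id := by ext <;> simp
      inv_hom_id := by ext <;> simp }
  have h₂ : IsAdmissibleMono E.exact (biprod.lift (0 : X ⟶ W) i) :=
    admissibleMono_of_iso h₁ (Iso.refl _) e (by ext <;> simp [e])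
  have hepi : Epi (biprod.map (𝟙 W) k) := inferInstance
  have h₃ : E.exact (ShortComplex.mk (biprod.lift (0 : X ⟶ W) i) (biprod.map (𝟙 W) k)
      (by ext <;> simp [w])) := by
    refine exact_of_cokernel _ h₂ (fun t ht ↦ ?_)
    obtain ⟨l, hl⟩ := hk (biprod.inr ≫ t) (by simpa [biprod.lift_eq] using ht)
    exact ⟨biprod.desc (biprod.inl ≫ t) l, by ext <;> simp [hl]⟩
  have hkadm : IsAdmissibleEpi E.exact k := by
    refine admissibleEpi_of_isPullback (p := biprod.map (𝟙 W) k) (f := biprod.inr)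
      (f' := biprod.inr) ⟨⟨by simp⟩, ⟨PullbackCone.IsLimit.mk _
        (fun s ↦ s.fst ≫ biprod.snd) ?_ ?_ ?_⟩⟩ ⟨_, _, _, h₃⟩
    · intro s
      have := congrArg (· ≫ biprod.fst) s.condition
      ext
      · simpa using this.symm
      · simp
    · intro s
      simpa using congrArg (· ≫ biprod.snd) s.condition
    · intro s m h₁ h₂
      simp [← h₁]
  have := mono_of_exact h₃
  have : Mono i := by
    rw [Preadditive.mono_iff_cancel_zero]
    intro T t ht
    rw [← cancel_mono (biprod.lift (0 : X ⟶ W) i), zero_comp]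
    ext <;> simp [ht]
  refine exact_of_kernel _ hkadm (fun t ht ↦ ?_)
  obtain ⟨l, hl⟩ := exists_lift h₃ (t ≫ biprod.inr)
    (by simp [reassoc_of% ht])
  exact ⟨l, by simpa using congrArg (· ≫ biprod.snd) hl⟩

variable [HasBinaryBiproducts A]

lemma exact_biprod {X Y Z X' Y' Z' : A} {i : X ⟶ Y} {p : Y ⟶ Z} {w : i ≫ p = 0}
    (h : E.exact (ShortComplex.mk i p w)) {i' : X' ⟶ Y'} {p' : Y' ⟶ Z'} {w' : i' ≫ p' = 0}
    (h' : E.exact (ShortComplex.mk i' p' w')) :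
    E.exact (ShortComplex.mk (biprod.map i i') (biprod.map p p') (by ext <;> simp [w, w'])) := by
  have hi₁ : IsAdmissibleMono E.exact (biprod.map i (𝟙 X')) :=
    admissibleMono_of_isPushout (i := i) (f := biprod.inl) (f' := biprod.inl)
      ⟨⟨by simp⟩, ⟨PushoutCocone.IsColimit.mk _
        (fun s ↦ biprod.desc s.inl (biprod.inr ≫ s.inr)) (by simp) (by
          intro s
          ext
          · simpa using s.condition
          · simp) (by
          intro s m h₁ h₂
          ext
          · simp [h₁]
          · simp [← h₂])⟩⟩ ⟨_, _, _, h⟩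
  have hi₂ : IsAdmissibleMono E.exact (biprod.map (𝟙 Y) i') :=
    admissibleMono_of_isPushout (i := i') (f := biprod.inr) (f' := biprod.inr)
      ⟨⟨by simp⟩, ⟨PushoutCocone.IsColimit.mk _
        (fun s ↦ biprod.desc (biprod.inl ≫ s.inr) s.inl) (by simp) (by
          intro s
          ext
          · simp
          · simpa using s.condition) (by
          intro s m h₁ h₂
          ext
          · simp [← h₂]
          · simp [h₁])⟩⟩ ⟨_, _, _, h'⟩
  have hi : IsAdmissibleMono E.exact (biprod.map i i') := by
    convert E.mono_comp _ _ hi₁ hi₂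
    ext <;> simp
  have := epi_of_exact h
  have := epi_of_exact h'
  have : Epi (biprod.map p p') := inferInstance
  refine exact_of_cokernel _ hi (fun t ht ↦ ?_)
  obtain ⟨l, hl⟩ := exists_desc h (biprod.inl ≫ t) (by
    simpa using congrArg (biprod.inl ≫ ·) ht)
  obtain ⟨l', hl'⟩ := exists_desc h' (biprod.inr ≫ t) (by
    simpa using congrArg (biprod.inr ≫ ·) ht)
  exact ⟨biprod.desc l l', by ext <;> simp [hl, hl']⟩

lemma IsAcyclic.biprod {K L : CochainComplex A ℤ} (hK : E.IsAcyclic K) (hL : E.IsAcyclic L) :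
    E.IsAcyclic (K ⊞ L) := by
  obtain ⟨Z, i, p, w, hE, hd⟩ := hK
  obtain ⟨Z', i', p', w', hE', hd'⟩ := hL
  let e (n : ℤ) : (K ⊞ L).X n ≅ K.X n ⊞ L.X n := HomologicalComplex.biprodXIso K L n
  have w₀ (n m : ℤ) (h : n + 1 = m) :
      biprod.map (i n) (i' n) ≫ biprod.map (p n m h) (p' n m h) = 0 := by
    ext <;> simp [w, w']
  have w₁ (n m : ℤ) (h : n + 1 = m) : (biprod.map (i n) (i' n) ≫ (e n).inv) ≫
      (e n).hom ≫ biprod.map (p n m h) (p' n m h) = 0 := by simp [w₀]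
  refine ⟨fun n ↦ Z n ⊞ Z' n, fun n ↦ biprod.map (i n) (i' n) ≫ (e n).inv,
    fun n m h ↦ (e n).hom ≫ biprod.map (p n m h) (p' n m h), w₁, fun n m h ↦
    E.exact_of_iso (ShortComplex.isoMk (S₁ := .mk _ _ (w₀ n m h)) (S₂ := .mk _ _ (w₁ n m h))
      (Iso.refl _) (e n).symm (Iso.refl _) (by simp) (by simp))
      (exact_biprod (hE n m h) (hE' n m h)), fun n m h ↦ ?_⟩
  have : biprod.map (p n m h) (p' n m h) ≫ biprod.map (i m) (i' m) =
      biprod.map (K.d n m) (L.d n m) := by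
    rw [← hd n m h, ← hd' n m h]
    ext <;> simp
  rw [assoc, reassoc_of% this, ← cancel_epi (e n).inv, Iso.inv_hom_id_assoc]
  ext <;> simp [e]

variable [IsIdempotentComplete A]

/-- Splitting the idempotent `𝟙 Y - r ≫ i` supplies a complement, hence a cokernel of `i`. The
obscure axiom applies because `i ≫ r` is an identity. -/
lemma admissibleMono_of_retract {X Y : A} (i : X ⟶ Y) (r : Y ⟶ X) (h : i ≫ r = 𝟙 X) :
    IsAdmissibleMono E.exact i := by
  obtain ⟨Z, j, k, hjk, hkj⟩ := IsIdempotentComplete.idempotents_split Y (𝟙 Y - r ≫ i)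
    (by simp [reassoc_of% h])
  have hk : i ≫ k = 0 := by
    have : (i ≫ k) ≫ j = 0 := by rw [assoc, hkj]; simp [reassoc_of% h]
    simpa [hjk] using congrArg (· ≫ k) this
  have : Epi k := ⟨fun a b hab ↦ by simpa [reassoc_of% hjk] using congrArg (j ≫ ·) hab⟩
  refine ⟨Z, k, hk, exact_of_admissibleMono_comp (j := r) hk (by rw [h]; exact E.mono_id X)
    (fun t ht ↦ ⟨j ≫ t, ?_⟩)⟩
  rw [reassoc_of% hkj]
  simp [ht]

/-- In an idempotent complete exact category, a retract of an exact sequence is exact. -/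
lemma exact_of_retract {S T : ShortComplex A} (h : Retract S T) (hT : E.exact T) :
    E.exact S := by
  obtain ⟨s, r, hsr⟩ := h
  have h₁ : s.τ₁ ≫ r.τ₁ = 𝟙 _ := by rw [← ShortComplex.comp_τ₁, hsr]; rfl
  have h₂ : s.τ₂ ≫ r.τ₂ = 𝟙 _ := by rw [← ShortComplex.comp_τ₂, hsr]; rfl
  have h₃ : s.τ₃ ≫ r.τ₃ = 𝟙 _ := by rw [← ShortComplex.comp_τ₃, hsr]; rfl
  have hTf : IsAdmissibleMono E.exact T.f := ⟨_, _, _, hT⟩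
  have := epi_of_exact hT
  have : Epi S.g := ⟨fun a b hab ↦ by
    have : r.τ₃ ≫ a = r.τ₃ ≫ b := by
      rw [← cancel_epi T.g, ← assoc, ← r.comm₂₃, assoc, hab, ← assoc, r.comm₂₃, assoc]
    simpa [reassoc_of% h₃] using congrArg (s.τ₃ ≫ ·) this⟩
  refine exact_of_admissibleMono_comp (j := s.τ₂) S.zero ?_ (fun t ht ↦ ?_)
  · rw [← s.comm₁₂]
    exact E.mono_comp _ _ (admissibleMono_of_retract _ _ h₁) hTf
  · obtain ⟨l, hl⟩ := exists_desc hT (r.τ₂ ≫ t) (by rw [← assoc, ← r.comm₁₂, assoc, ht, comp_zero])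
    exact ⟨s.τ₃ ≫ l, by rw [← assoc, ← s.comm₂₃, assoc, hl, reassoc_of% h₂]⟩

lemma IsAcyclic.of_retract {K L : CochainComplex A ℤ} (h : Retract K L) (hL : E.IsAcyclic L) :
    E.IsAcyclic K := by
  obtain ⟨s, r, hsr⟩ := h
  obtain ⟨Z, i, p, w, hE, hd⟩ := hL
  have hsr' (n : ℤ) : s.f n ≫ r.f n = 𝟙 _ := by
    rw [← HomologicalComplex.comp_f, hsr, HomologicalComplex.id_f]
  have hi (n : ℤ) : Mono (i n) := mono_of_exact (hE n _ rfl)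
  have hp (n m : ℤ) (h : n + 1 = m) : Epi (p n m h) := epi_of_exact (hE n m h)
  -- The idempotent chain endomorphism `r ≫ s` of `L` restricts to the cycles. The images of the
  -- resulting idempotents are the cycles of `K`.
  have he (n : ℤ) : ∃ e : Z n ⟶ Z n, e ≫ i n = i n ≫ r.f n ≫ s.f n := by
    refine exists_lift (hE n _ rfl) _ ?_
    rw [← cancel_mono (i (n + 1)), assoc, hd, assoc, assoc, s.comm, r.comm_assoc, ← hd _ _ rfl,
      assoc, reassoc_of% (w n _ rfl), zero_comp, zero_comp]
  choose e he using he
  have hee (n : ℤ) : e n ≫ e n = e n := by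
    rw [← cancel_mono (i n), assoc, he, reassoc_of% (he n), reassoc_of% (hsr' n)]
  have hpe (n m : ℤ) (h : n + 1 = m) : p n m h ≫ e m = r.f n ≫ s.f n ≫ p n m h := by
    rw [← cancel_mono (i m), assoc, he, ← assoc, hd, assoc, assoc, hd, s.comm, r.comm_assoc]
  choose W a b hab hba using fun n ↦ IsIdempotentComplete.idempotents_split (Z n) (e n) (hee n)
  have w₁ (n m : ℤ) (h : n + 1 = m) : (a n ≫ i n ≫ r.f n) ≫ s.f n ≫ p n m h ≫ b m = 0 := by
    simp only [assoc]
    rw [← reassoc_of% (he n), reassoc_of% (w n m h), zero_comp, comp_zero, comp_zero]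
  refine ⟨W, fun n ↦ a n ≫ i n ≫ r.f n, fun n m h ↦ s.f n ≫ p n m h ≫ b m, w₁,
    fun n m h ↦ exact_of_retract (T := .mk _ _ (w n m h)) ⟨⟨a n, s.f n, a m, ?_, ?_⟩,
      ⟨b n, r.f n, b m, ?_, ?_⟩, ?_⟩ (hE n m h), fun n m h ↦ ?_⟩
  · dsimp
    rw [assoc, assoc, ← he, ← hba n, assoc, reassoc_of% (hab n)]
  · dsimp
    rw [assoc, assoc, hba, hpe, reassoc_of% (hsr' n)]
  · dsimp
    rw [reassoc_of% (hba n), reassoc_of% (he n), hsr', comp_id]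
  · dsimp
    rw [← reassoc_of% (hpe n m h), ← hba m, assoc, hab, comp_id]
  · ext
    · exact hab n
    · exact hsr' n
    · exact hab m
  · simp only [assoc]
    rw [reassoc_of% (hba m), reassoc_of% (he m), hsr', comp_id, reassoc_of% (hd n m h), ← r.comm,
      reassoc_of% (hsr' n)]

/-- A split sequence is exact. -/
lemma exact_of_splitting {S : ShortComplex A} (σ : S.Splitting) : E.exact S := by
  have : Epi S.g := ⟨fun a b hab ↦ by simpa using congrArg (σ.s ≫ ·) hab⟩
  exact exact_of_cokernel S.zero (admissibleMono_of_retract _ _ σ.f_r) (fun t ht ↦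
    ⟨σ.s ≫ t, by rw [← assoc, σ.g_s]; simp [ht]⟩)

lemma IsAcyclic.mappingCone_id (K : CochainComplex A ℤ) :
    E.IsAcyclic (CochainComplex.mappingCone (𝟙 K)) := by
  -- The cycles of the cone in degree `n` are the pairs `(-d x, x)`, hence a copy of `K.X n`.
  let i (n m : ℤ) (h : n + 1 = m) : K.X n ⟶ (CochainComplex.mappingCone (𝟙 K)).X n :=
    (CochainComplex.mappingCone.inr (𝟙 K)).f n -
      K.d n m ≫ (CochainComplex.mappingCone.inl (𝟙 K)).v m n (by lia)
  let p (n m : ℤ) (h : n + 1 = m) : (CochainComplex.mappingCone (𝟙 K)).X n ⟶ K.X m :=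
    (CochainComplex.mappingCone.fst (𝟙 K)).1.v n m h +
      (CochainComplex.mappingCone.snd (𝟙 K)).v n n (add_zero n) ≫ K.d n m
  have w (n m : ℤ) (h : n + 1 = m) : i n m h ≫ p n m h = 0 := by
    simp [i, p]
  refine ⟨fun n ↦ K.X n, fun n ↦ i n (n + 1) rfl, p, fun n m h ↦ by subst h; exact w _ _ _,
    fun n m h ↦ ?_, fun n m h ↦ ?_⟩
  · subst h
    refine exact_of_splitting (S := .mk _ _ (w n _ rfl))
      ⟨(CochainComplex.mappingCone.snd (𝟙 K)).v n n (add_zero n),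
        (CochainComplex.mappingCone.inl (𝟙 K)).v (n + 1) n (by lia), ?_, ?_, ?_⟩
    · simp [i]
    · simp [p]
    · simp [i, p, CochainComplex.mappingCone.ext_from_iff _ _ _ rfl]
  · rw [CochainComplex.mappingCone.ext_from_iff _ _ _ h]
    constructor
    · rw [CochainComplex.mappingCone.inl_v_d (𝟙 K) m n (m + 1) (by lia) (by lia)]
      simp [i, p]
    · simp [i, p]

/-- Over an idempotent complete exact category, acyclic complexes are closed under retracts in
the homotopy category. -/
lemma IsAcyclic.of_homotopy {K L : CochainComplex A ℤ} (s : K ⟶ L) (r : L ⟶ K)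
    (h : Homotopy (𝟙 K) (s ≫ r)) (hL : E.IsAcyclic L) : E.IsAcyclic K := by
  -- The null-homotopic map `𝟙 K - s ≫ r` factors through the contractible cone of `𝟙 K`. Adding
  -- this cone to `L` turns a retract up to homotopy into a retract of complexes.
  refine IsAcyclic.of_retract (L := L ⊞ CochainComplex.mappingCone (𝟙 K))
    ⟨biprod.lift s (CochainComplex.mappingCone.inr _), biprod.desc r
      (CochainComplex.mappingCone.desc (𝟙 K)
        (CochainComplex.HomComplex.Cochain.ofHomotopy h) (𝟙 K - s ≫ r) ?_), ?_⟩
    (hL.biprod (IsAcyclic.mappingCone_id K))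
  · simp
  · simp

end Retracts

variable {A : Type u} [Category.{v} A] [Preadditive A] [IsIdempotentComplete A]
  [HasBinaryBiproducts A] (E : ExactStructure A)

lemma isAcyclic_of_retract_homotopyCategory {K L : CochainComplex A ℤ}
    (h : Retract ((HomotopyCategory.quotient A (ComplexShape.up ℤ)).obj K)
      ((HomotopyCategory.quotient A (ComplexShape.up ℤ)).obj L))
    (hL : E.IsAcyclic L) : E.IsAcyclic K := by
  obtain ⟨s, hs⟩ := (HomotopyCategory.quotient A (ComplexShape.up ℤ)).map_surjective h.i
  obtain ⟨r, hr⟩ := (HomotopyCategory.quotient A (ComplexShape.up ℤ)).map_surjective h.r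
  exact IsAcyclic.of_homotopy s r (HomotopyCategory.homotopyOfEq _ _ (by
    rw [Functor.map_comp, hs, hr, h.retract, CategoryTheory.Functor.map_id])) hL

lemma acyclic_iff (K : BoundedHomotopyCategory A) : E.acyclic K ↔ E.IsAcyclic K.obj.as := by
  refine ⟨?_, fun h ↦ ⟨K, h, ⟨Iso.refl _⟩⟩⟩
  rintro ⟨L, hL, ⟨e⟩⟩
  exact E.isAcyclic_of_retract_homotopyCategory (e.retract.map (boundedComplexes A).ι) hL

/-- Needed for `trW_of_isIso_map`: a morphism inverted in `D^b(A)` then has an acyclic cone. -/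
instance : E.acyclic.IsStableUnderRetracts where
  of_retract {K L} h hL := by
    rw [acyclic_iff] at hL ⊢
    exact E.isAcyclic_of_retract_homotopyCategory (h.map (boundedComplexes A).ι) hL

end ExactStructure

/-! ### Factorizations through triangulated subcategories -/

namespace CategoryTheory

section Yoneda

variable {T : Type*} [Category* T] [HasZeroObject T] [HasShift T ℤ] [Preadditive T]
  [∀ n : ℤ, (shiftFunctor T n).Additive] [Pretriangulated T]
  {X₁ X₂ X₃ : T} {f : X₁ ⟶ X₂} {g : X₂ ⟶ X₃} {h : X₃ ⟶ X₁⟦(1 : ℤ)⟧}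

lemma Pretriangulated.exists_desc₂ (hT : Triangle.mk f g h ∈ distTriang T) {Y : T} (φ : X₂ ⟶ Y)
    (hφ : f ≫ φ = 0) : ∃ ψ : X₃ ⟶ Y, φ = g ≫ ψ :=
  Triangle.yoneda_exact₂ (Triangle.mk f g h) hT φ hφ

lemma Pretriangulated.exists_desc₃ (hT : Triangle.mk f g h ∈ distTriang T) {Y : T} (φ : X₃ ⟶ Y)
    (hφ : g ≫ φ = 0) : ∃ ψ : X₁⟦(1 : ℤ)⟧ ⟶ Y, φ = h ≫ ψ :=
  Triangle.yoneda_exact₃ (Triangle.mk f g h) hT φ hφ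

lemma Pretriangulated.exists_lift₂ (hT : Triangle.mk f g h ∈ distTriang T) {Y : T} (φ : Y ⟶ X₂)
    (hφ : φ ≫ g = 0) : ∃ ψ : Y ⟶ X₁, φ = ψ ≫ f :=
  Triangle.coyoneda_exact₂ (Triangle.mk f g h) hT φ hφ

lemma Pretriangulated.exists_lift₃ (hT : Triangle.mk f g h ∈ distTriang T) {Y : T} (φ : Y ⟶ X₃)
    (hφ : φ ≫ h = 0) : ∃ ψ : Y ⟶ X₂, φ = ψ ≫ g :=
  Triangle.coyoneda_exact₃ (Triangle.mk f g h) hT φ hφ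

end Yoneda

namespace ObjectProperty

variable {T : Type*} [Category* T] [HasZeroObject T] [HasShift T ℤ] [Preadditive T]
  [∀ n : ℤ, (shiftFunctor T n).Additive] [Pretriangulated T]

/-- The objects `X` such that any morphism from `X` to an object of `Q` factors through an object
of `P ⊓ Q`. -/
def leftFactorizable (P Q : ObjectProperty T) : ObjectProperty T :=
  fun X ↦ ∀ ⦃Y : T⦄ (f : X ⟶ Y), Q Y → ∃ (Z : T) (a : X ⟶ Z) (b : Z ⟶ Y), P Z ∧ Q Z ∧ a ≫ b = f

variable {P Q : ObjectProperty T}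

lemma leftFactorizable_of_prop {X : T} (h : P X) (h' : Q X) : leftFactorizable P Q X :=
  fun _ f _ ↦ ⟨X, 𝟙 X, f, h, h', id_comp f⟩

/-- Push `φ` to the cone `Y'` of `j`, where it descends to `X₃` and so factors through some `J₂` in
both subcategories. The extension `J₃` of `J₂` by `J`, pulled back from `J ⟶ Y ⟶ Y'`, is the object
through which `φ` factors. -/
lemma exists_fac_of_distinguished [P.IsTriangulated] [Q.IsTriangulated]
    [P.IsClosedUnderIsomorphisms] [Q.IsClosedUnderIsomorphisms]
    {X₁ X₂ X₃ : T} {f : X₁ ⟶ X₂} {g : X₂ ⟶ X₃} {h : X₃ ⟶ X₁⟦(1 : ℤ)⟧}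
    (hT : Triangle.mk f g h ∈ distTriang T) (h₃ : leftFactorizable P Q X₃)
    {Y : T} (φ : X₂ ⟶ Y) (hY : Q Y) {J : T} (v : X₁ ⟶ J) (j : J ⟶ Y) (hJ : P J) (hJ' : Q J)
    (hv : v ≫ j = f ≫ φ) :
    ∃ (Z : T) (a : X₂ ⟶ Z) (b : Z ⟶ Y), P Z ∧ Q Z ∧ a ≫ b = φ := by
  obtain ⟨Y', n, δ, hY'⟩ := distinguished_cocone_triangle j
  obtain ⟨ψ, hψ⟩ := exists_desc₂ hT (φ ≫ n) (by
    have : j ≫ n = 0 := comp_distTriang_mor_zero₁₂ _ hY'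
    rw [← assoc, ← hv, assoc, this, comp_zero])
  obtain ⟨J₂, a, b, hJ₂, hJ₂', rfl⟩ := h₃ ψ (Q.ext_of_isTriangulatedClosed₃ _ hY' hJ' hY)
  obtain ⟨J₃, α, β, hJ₃⟩ := distinguished_cocone_triangle₂ (b ≫ δ)
  obtain ⟨m, hm₁, hm₂⟩ : ∃ m : J₃ ⟶ Y, α ≫ m = 𝟙 J ≫ j ∧ β ≫ b = m ≫ n :=
    complete_distinguished_triangle_morphism₂ _ _ hJ₃ hY' (𝟙 J) b
    (show (b ≫ δ) ≫ (𝟙 J)⟦(1 : ℤ)⟧' = b ≫ δ by simp)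
  obtain ⟨k, hk⟩ := exists_lift₃ hJ₃ (g ≫ a) (by
    have : n ≫ δ = 0 := comp_distTriang_mor_zero₂₃ _ hY'
    rw [assoc, ← reassoc_of% hψ, this, comp_zero])
  -- The lift `k` is correct only after mapping to `Y'`. The error comes from `J` and is absorbed
  -- through `α`.
  obtain ⟨t, ht⟩ := exists_lift₂ hY' (φ - k ≫ m) (by
    rw [Preadditive.sub_comp, assoc, ← hm₂, ← reassoc_of% hk, hψ, sub_self])
  refine ⟨J₃, k + t ≫ α, m, P.ext_of_isTriangulatedClosed₂ _ hJ₃ hJ hJ₂,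
    Q.ext_of_isTriangulatedClosed₂ _ hJ₃ hJ' hJ₂', ?_⟩
  rw [Preadditive.add_comp, assoc, hm₁, id_comp, ← ht, add_sub_cancel]

instance : (leftFactorizable P Q).IsClosedUnderIsomorphisms where
  of_iso e h Y f hY := by
    obtain ⟨Z, a, b, hZ, hZ', fac⟩ := h (e.hom ≫ f) hY
    exact ⟨Z, e.inv ≫ a, b, hZ, hZ', by rw [assoc, fac, e.inv_hom_id_assoc]⟩

lemma exists_fac_shift [P.IsStableUnderShift ℤ] [Q.IsStableUnderShift ℤ]
    [Q.IsClosedUnderIsomorphisms] {X Y : T} {n m : ℤ} (hnm : n + m = 0) (f : X⟦n⟧ ⟶ Y)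
    (h : ∀ g : X ⟶ Y⟦m⟧, ∃ (Z : T) (a : X ⟶ Z) (b : Z ⟶ Y⟦m⟧), P Z ∧ Q Z ∧ a ≫ b = g) :
    ∃ (Z : T) (a : X⟦n⟧ ⟶ Z) (b : Z ⟶ Y), P Z ∧ Q Z ∧ a ≫ b = f := by
  let e := (shiftFunctorCompIsoId T m n (by lia)).app Y
  obtain ⟨g, hg⟩ := (shiftFunctor T n).map_surjective (f ≫ e.inv)
  obtain ⟨Z, a, b, hZ, hZ', fac⟩ := h g
  refine ⟨Z⟦n⟧, a⟦n⟧', b⟦n⟧' ≫ e.hom, P.le_shift n _ hZ, Q.le_shift n _ hZ', ?_⟩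
  rw [← assoc, ← Functor.map_comp, fac, hg, assoc, e.inv_hom_id]
  exact comp_id f

instance [P.IsTriangulated] [Q.IsTriangulated]
    [P.IsClosedUnderIsomorphisms] [Q.IsClosedUnderIsomorphisms] :
    (leftFactorizable P Q).IsTriangulated where
  exists_zero := ⟨0, isZero_zero T, leftFactorizable_of_prop P.prop_zero Q.prop_zero⟩
  isStableUnderShiftBy n :=
    { le_shift _ h _ f hY := exists_fac_shift (add_neg_cancel n) f
        (fun g ↦ h g (Q.le_shift _ _ hY)) }
  toIsTriangulatedClosed₂ := .mk' (fun t ht h₁ h₃ Y f hY ↦ by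
    obtain ⟨J, v, j, hJ, hJ', fac⟩ := h₁ (t.mor₁ ≫ f) hY
    exact exists_fac_of_distinguished ht h₃ f hY v j hJ hJ' fac)

/-- The smallest triangulated subcategory (closed under isomorphisms) containing given objects. -/
def triangulatedClosure (P : ObjectProperty T) : ObjectProperty T :=
  fun X ↦ ∀ Q : ObjectProperty T, Q.IsTriangulated → Q.IsClosedUnderIsomorphisms → P ≤ Q → Q X

lemma le_triangulatedClosure (P : ObjectProperty T) : P ≤ P.triangulatedClosure :=
  fun _ hX _ _ _ h ↦ h _ hX

lemma triangulatedClosure_le {P Q : ObjectProperty T} [hQ : Q.IsTriangulated]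
    [hQ' : Q.IsClosedUnderIsomorphisms] (h : P ≤ Q) : P.triangulatedClosure ≤ Q :=
  fun _ hX ↦ hX Q hQ hQ' h

instance (P : ObjectProperty T) : P.triangulatedClosure.IsClosedUnderIsomorphisms where
  of_iso e h Q hQ hQ' hPQ := Q.prop_of_iso e (h Q hQ hQ' hPQ)

instance (P : ObjectProperty T) : P.triangulatedClosure.IsTriangulated where
  exists_zero := ⟨0, isZero_zero T, fun Q _ _ _ ↦ Q.prop_zero⟩
  isStableUnderShiftBy n :=
    { le_shift _ h Q hQ hQ' hPQ := Q.le_shift n _ (h Q hQ hQ' hPQ) }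
  toIsTriangulatedClosed₂ := .mk' (fun t ht h₁ h₃ Q hQ hQ' hPQ ↦
    Q.ext_of_isTriangulatedClosed₂ t ht (h₁ Q hQ hQ' hPQ) (h₃ Q hQ hQ' hPQ))

/-- Since `leftFactorizable` is itself a triangulated subcategory, the factorization property need
only be checked on generators. -/
lemma isVerdierLeftLocalizing_triangulatedClosure [Q.IsTriangulated]
    [Q.IsClosedUnderIsomorphisms] (h : P ≤ leftFactorizable P.triangulatedClosure Q) :
    P.triangulatedClosure.IsVerdierLeftLocalizing Q where
  fac f hX hY := triangulatedClosure_le h _ hX f hY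

/-! ### Retracts of objects of a triangulated subcategory -/

section Retract

/-- The essential point is that an extension of retracts is a retract of an extension. -/
instance [P.IsTriangulated] : P.retractClosure.IsTriangulated where
  exists_zero := by
    obtain ⟨Z, hZ, hPZ⟩ := P.exists_prop_of_containsZero
    exact ⟨Z, hZ, P.le_retractClosure _ hPZ⟩
  isStableUnderShiftBy n :=
    { le_shift := by
        rintro X ⟨Y, hY, ⟨r⟩⟩
        exact ⟨Y⟦n⟧, P.le_shift n _ hY, ⟨r.map (shiftFunctor T n)⟩⟩ }
  toIsTriangulatedClosed₂ := .mk' (fun t ht h₁ h₃ ↦ by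
    obtain ⟨Y, ⟨_, _, _, _, _, hT, h₁', h₃'⟩, r⟩ :=
      extensionProduct_retractClosure_retractClosure_le P P _ ⟨_, _, _, _, _, ht, h₁, h₃⟩
    obtain ⟨Y', hY', ⟨e⟩⟩ := P.ext_of_isTriangulatedClosed₂' _ hT h₁' h₃'
    exact ⟨Y', hY', ⟨r.some.trans e.retract⟩⟩)

/-- If `X` is a retract of an object of a triangulated subcategory, then `X⟦1⟧ ⊞ X` belongs to
the triangulated subcategory. -/
lemma shift_biprod_of_retract [IsTriangulated T] [P.IsTriangulated] [P.IsClosedUnderIsomorphisms]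
    {X Y : T} (r : Retract X Y) (hY : P Y) : P (X⟦(1 : ℤ)⟧ ⊞ X) := by
  obtain ⟨U, q, w, hq⟩ := distinguished_cocone_triangle r.i
  have hrepi : w = 0 := by
    have hmono : Mono r.i := inferInstance
    exact (Triangle.mor₃_eq_zero_iff_mono₁ _ hq).2 hmono
  subst hrepi
  obtain ⟨b, hb⟩ := exists_desc₂ hq (𝟙 Y - r.r ≫ r.i) (by
    rw [Preadditive.comp_sub, r.retract_assoc, comp_id, sub_self])
  have hqepi : Epi q := (Triangle.mor₃_eq_zero_iff_epi₂ _ hq).1 rfl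
  have hiq : r.i ≫ q = 0 := comp_distTriang_mor_zero₁₂ _ hq
  have hbq : b ≫ q = 𝟙 U := by
    rw [← cancel_epi q, ← reassoc_of% hb]
    simp [hiq]
  have hbr : b ≫ r.r = 0 := by
    rw [← cancel_epi q, ← reassoc_of% hb]
    simp
  have hbmono : Mono b := mono_of_mono_fac hbq
  obtain ⟨X', c, d, hX'⟩ := distinguished_cocone_triangle b
  have hd : d = 0 := (Triangle.mor₃_eq_zero_iff_mono₁ _ hX').2 hbmono
  subst hd
  obtain ⟨c', hc'⟩ := exists_desc₂ hX' r.r hbr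
  have hcepi : Epi c := (Triangle.mor₃_eq_zero_iff_epi₂ _ hX').1 rfl
  have hbc : b ≫ c = 0 := comp_distTriang_mor_zero₁₂ _ hX'
  let e : X' ≅ X := ⟨c', r.i ≫ c, by
    rw [← cancel_epi c, ← reassoc_of% hc', ← assoc,
      show r.r ≫ r.i = 𝟙 Y - q ≫ b by rw [← hb]; abel]
    simp [hbc], by rw [assoc, ← hc', r.retract]⟩
  -- The morphism `q ≫ b` is the idempotent of `Y` complementary to `r.r ≫ r.i`, so its cone lies in
  -- `P`. By the octahedral axiom this cone is an extension of `X' ≅ X` by `X⟦1⟧`, and it splits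
  -- because the connecting morphism involves the zero third morphism of the triangle on `b`.
  obtain ⟨Z, f, g, hZ⟩ := distinguished_cocone_triangle (q ≫ b)
  have o := Triangulated.someOctahedron rfl (rot_of_distTriang _ hq) hX' hZ
  obtain ⟨e', -⟩ := exists_iso_binaryBiproduct_of_distTriang _ o.mem zero_comp
  exact P.prop_of_iso (e' ≪≫ biprod.mapIso (Iso.refl _) e)
    (P.ext_of_isTriangulatedClosed₃ _ hZ hY hY)

end Retract

/-! ### Images of triangulated subcategories in Verdier quotients -/

section Localization

lemma isStableUnderShift_map {T D : Type*} [Category* T] [Category* D] [HasShift T ℤ]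
    [HasShift D ℤ] (L : T ⥤ D) [L.CommShift ℤ] {P : ObjectProperty T} [P.IsStableUnderShift ℤ] :
    (P.map L).IsStableUnderShift ℤ where
  isStableUnderShiftBy n :=
    { le_shift := by
        rintro Y ⟨X, hX, ⟨e⟩⟩
        exact ⟨X⟦n⟧, P.le_shift n _ hX,
          ⟨(L.commShiftIso n).app _ ≪≫ (shiftFunctor D n).mapIso e⟩⟩ }

variable [IsTriangulated T] {D : Type*} [Category* D] [HasZeroObject D] [HasShift D ℤ]
  [Preadditive D] [∀ n : ℤ, (shiftFunctor D n).Additive] [Pretriangulated D]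
  (L : T ⥤ D) [Q.IsTriangulated] [L.IsLocalization Q.trW]

/-- A morphism with invertible image in a Verdier quotient has its cone in the thick
subcategory which is divided out. -/
lemma trW_of_isIso_map [L.CommShift ℤ] [L.IsTriangulated] [Q.IsStableUnderRetracts]
    {X Y : T} (f : X ⟶ Y) [IsIso (L.map f)] : Q.trW f := by
  obtain ⟨Z, g, h, hT⟩ := distinguished_cocone_triangle f
  refine ⟨Z, g, h, hT, ?_⟩
  have hZ : IsZero (L.obj Z) :=
    (Triangle.isZero₃_iff_isIso₁ _ (L.map_distinguished _ hT)).2 (inferInstanceAs (IsIso (L.map f)))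
  -- That `Z` dies in the quotient means that the zero morphism `Z ⟶ Z'` has its cone in `Q`. Such a
  -- cone contains `Z⟦1⟧` as a retract.
  obtain ⟨Z', s, hs, fac⟩ := (MorphismProperty.map_eq_iff_postcomp L Q.trW (𝟙 Z) 0).1
    (hZ.eq_of_src _ _)
  obtain rfl : s = 0 := by simpa using fac
  obtain ⟨W, a, b, hT', hW⟩ := hs
  have : Epi b := (Triangle.mor₁_eq_zero_iff_epi₃ _ hT').1 rfl
  have := isSplitEpi_of_epi b
  have hZ₁ : Q (Z⟦(1 : ℤ)⟧) := Q.prop_of_retract ⟨section_ b, b, by simp⟩ hW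
  exact (Q.prop_shift_iff_of_isStableUnderShift Z 1).1 hZ₁

variable [P.IsTriangulated] [P.IsClosedUnderIsomorphisms] [Q.IsClosedUnderIsomorphisms]
  [P.IsVerdierLeftLocalizing Q]

/-- Any right fraction can be refined: its denominator has target in `P`, so it is dominated by a
denominator with source in `P`. -/
lemma exists_rightFraction_of_isVerdierLeftLocalizing {X Y : T} (hX : P X)
    (φ : L.obj X ⟶ L.obj Y) :
    ∃ (X' : T) (s : X' ⟶ X) (f : X' ⟶ Y), P X' ∧ Q.trW s ∧ L.map s ≫ φ = L.map f := by
  obtain ⟨ψ, rfl⟩ := Localization.exists_rightFraction L Q.trW φ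
  obtain ⟨X', s, a, hX', hs, rfl⟩ :=
    IsVerdierLeftLocalizing.fac' (A := P) ψ.s hX ψ.hs
  refine ⟨X', a ≫ ψ.s, a ≫ ψ.f, hX', trW_monotone inf_le_right _ hs, ?_⟩
  rw [L.map_comp, L.map_comp, assoc, MorphismProperty.RightFraction.map_s_comp_map]

/-- A morphism between images of `P` is isomorphic to the image of a morphism of `P`, by absorbing
the denominator of a fraction. Its cone can therefore be formed inside `P`. -/
lemma isTriangulated_map_of_isVerdierLeftLocalizing (Q : ObjectProperty T) [Q.IsTriangulated]
    [L.IsLocalization Q.trW] [Q.IsClosedUnderIsomorphisms] [P.IsVerdierLeftLocalizing Q]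
    [L.CommShift ℤ] [L.IsTriangulated] :
    (P.map L).IsTriangulated where
  exists_zero := ⟨L.obj 0, L.map_isZero (isZero_zero T), P.prop_map_obj L P.prop_zero⟩
  toIsStableUnderShift := isStableUnderShift_map L
  toIsTriangulatedClosed₂ :=
    have : (P.map L).IsStableUnderShift ℤ := isStableUnderShift_map L
    have : (P.map L).IsTriangulatedClosed₃ := .mk' (by
      rintro t ht ⟨X, hX, ⟨e⟩⟩ ⟨Y, hY, ⟨e'⟩⟩
      obtain ⟨X', s, f, hX', hs, hsf⟩ := exists_rightFraction_of_isVerdierLeftLocalizing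
        (P := P) (Q := Q) L hX (e.hom ≫ t.mor₁ ≫ e'.inv)
      have := Localization.inverts L Q.trW s hs
      obtain ⟨Z, g, h, hT⟩ := distinguished_cocone_triangle f
      obtain ⟨e'', -⟩ := exists_iso_of_arrow_iso _ _ (L.map_distinguished _ hT) ht
        (Arrow.isoMk (f := Arrow.mk (L.map f)) (g := Arrow.mk t.mor₁) (asIso (L.map s) ≪≫ e) e'
          (by simp [← hsf]))
      exact ⟨Z, P.ext_of_isTriangulatedClosed₃ _ hT hX' hY, ⟨Triangle.π₃.mapIso e''⟩⟩)
    .of_isTriangulatedClosed₃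

end Localization

end ObjectProperty

end CategoryTheory

/-! ### From exact sequences to distinguished triangles -/

namespace ExactStructure

section

variable {A : Type u} [Category.{v} A] [Preadditive A] [HasBinaryBiproducts A]
  [IsIdempotentComplete A] {E : ExactStructure A}

lemma exact_of_isZero_of_isIso {S : ShortComplex A} (h : IsZero S.X₁) [IsIso S.g] : E.exact S :=
  exact_of_splitting ⟨0, inv S.g, h.eq_of_src _ _, by simp, by simp⟩

lemma exact_of_isIso_of_isZero {S : ShortComplex A} [IsIso S.f] (h : IsZero S.X₃) : E.exact S :=
  exact_of_splitting ⟨inv S.f, 0, by simp, h.eq_of_src _ _, by simp⟩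

/-- A complex concentrated in degrees `-2`, `-1`, `0` given by an exact sequence is acyclic. -/
lemma isAcyclic_of_exact {K : CochainComplex A ℤ} (h₁ : ∀ n < -2, IsZero (K.X n))
    (h₂ : ∀ n > 0, IsZero (K.X n))
    (h : E.exact (ShortComplex.mk (K.d (-2) (-1)) (K.d (-1) 0) (by simp))) : E.IsAcyclic K := by
  -- The cycles are taken to be `K.X (m - 1)` in negative degrees and `K.X m` in the others. One of
  -- the two structure maps is then invertible, and only the sequence at `n = -1` has content.
  have key (m : ℤ) : ∃ (Z : A) (i : Z ⟶ K.X m) (p : ∀ n, n + 1 = m → (K.X n ⟶ Z)),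
      (∀ n h, p n h ≫ i = K.d n m) ∧ (m < 0 → ∀ n h, IsIso (p n h)) ∧ (0 ≤ m → IsIso i) := by
    by_cases hm : m < 0
    · refine ⟨K.X (m - 1), K.d _ _, fun n h ↦ (K.XIsoOfEq (by lia)).hom, fun n h ↦ by simp,
        fun _ n h ↦ inferInstance, fun h ↦ by lia⟩
    · exact ⟨K.X m, 𝟙 _, fun n h ↦ K.d n m, by simp, by lia, fun _ ↦ inferInstance⟩
  choose Z i p hd hp hi using key
  have w (n m : ℤ) (h : n + 1 = m) : i n ≫ p m n h = 0 := by
    by_cases hn : n < 0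
    · have := hp n hn (n - 1) (by lia)
      rw [← cancel_epi (p n (n - 1) (by lia)), reassoc_of% (hd n), comp_zero]
      by_cases hm : m < 0
      · exact (h₁ (n - 1) (by lia)).eq_of_src _ _
      · have := hi m (by lia)
        rw [← cancel_mono (i m), assoc, hd]
        simp
    · have := hi m (by lia)
      exact (IsZero.of_iso (h₂ m (by lia)) (asIso (i m))).eq_of_tgt _ _
  refine ⟨Z, i, fun n m h ↦ p m n h, w, fun n m h' ↦ ?_, fun n m h ↦ hd m n h⟩
  by_cases hn : n < -1
  · have hn' : n - 1 + 1 = n := by lia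
    have := hp n (by lia) (n - 1) hn'
    have : IsIso (ShortComplex.mk _ _ (w n m h')).g := hp m (by lia) n h'
    exact exact_of_isZero_of_isIso
      (IsZero.of_iso (h₁ (n - 1) (by lia)) (asIso (p n (n - 1) hn')).symm)
  · by_cases hn' : 0 ≤ n
    · have : IsIso (ShortComplex.mk _ _ (w n m h')).f := hi n hn'
      have := hi m (by lia)
      exact exact_of_isIso_of_isZero (IsZero.of_iso (h₂ m (by lia)) (asIso (i m)))
    · obtain rfl : n = -1 := by lia
      obtain rfl : m = 0 := by lia
      have hp' : (-2 : ℤ) + 1 = -1 := by lia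
      have := hp (-1) (by lia) (-2) hp'
      have := hi 0 (by lia)
      exact E.exact_of_iso (ShortComplex.isoMk (S₁ := .mk _ _ (by simp)) (S₂ := .mk _ _ (w (-1) 0 h'))
        (asIso (p (-1) (-2) hp')) (Iso.refl _) (asIso (i 0)).symm (by simp [hd])
        (by simp [← hd 0 (-1) h'])) h

end

end ExactStructure

section

variable (A : Type u) [Category.{v} A] [Preadditive A] [HasZeroObject A]

/-- The functor `A ⥤ K^b(A)` sending an object to the complex concentrated in degree zero. -/
noncomputable def singleBounded : A ⥤ BoundedHomotopyCategory A :=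
  (boundedComplexes A).lift
    (CochainComplex.singleFunctor A 0 ⋙ HomotopyCategory.quotient A (ComplexShape.up ℤ))
    (fun X ↦ ⟨0, 0,
      inferInstanceAs (CochainComplex.IsStrictlyGE ((CochainComplex.singleFunctor A 0).obj X) 0),
      inferInstanceAs (CochainComplex.IsStrictlyLE ((CochainComplex.singleFunctor A 0).obj X) 0)⟩)

end

namespace ExactStructure

variable {A : Type u} [Category.{v} A] [Preadditive A] [HasZeroObject A]
  [HasBinaryBiproducts A] [IsIdempotentComplete A] (E : ExactStructure A)

open CochainComplex in
-- The iterated cone is the sequence itself placed in degrees `-2`, `-1`, `0`, up to a sign.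
lemma isAcyclic_mappingCone_mappingCone {X Y Z : A} {i : X ⟶ Y} {p : Y ⟶ Z} {w : i ≫ p = 0}
    (h : E.exact (ShortComplex.mk i p w)) :
    E.IsAcyclic (mappingCone (mappingCone.desc ((singleFunctor A 0).map i) 0
      ((singleFunctor A 0).map p) (by rw [← Functor.map_comp, w]; simp))) := by
  set f := (singleFunctor A 0).map i
  set g := (singleFunctor A 0).map p
  set u := mappingCone.desc f 0 g _
  have hS (X : A) (n : ℤ) (hn : n ≠ 0) : IsZero (((singleFunctor A 0).obj X).X n) :=
    HomologicalComplex.isZero_single_obj_X _ _ _ _ hn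
  refine isAcyclic_of_exact (fun n hn ↦ ?_) (fun n hn ↦ ?_) ?_
  · rw [mappingCone.isZero_X_iff, mappingCone.isZero_X_iff]
    exact ⟨⟨hS _ _ (by lia), hS _ _ (by lia)⟩, hS _ _ (by lia)⟩
  · rw [mappingCone.isZero_X_iff, mappingCone.isZero_X_iff]
    exact ⟨⟨hS _ _ (by lia), hS _ _ (by lia)⟩, hS _ _ (by lia)⟩
  · let eX : X ≅ ((singleFunctor A 0).obj X).X 0 := (HomologicalComplex.singleObjXSelf _ 0 X).symm
    let eY : Y ≅ ((singleFunctor A 0).obj Y).X 0 := (HomologicalComplex.singleObjXSelf _ 0 Y).symm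
    let eZ : Z ≅ ((singleFunctor A 0).obj Z).X 0 := (HomologicalComplex.singleObjXSelf _ 0 Z).symm
    have hf : f.f 0 = eX.inv ≫ i ≫ eY.hom := HomologicalComplex.single_map_f_self _ 0 i
    have hg : g.f 0 = eY.inv ≫ p ≫ eZ.hom := HomologicalComplex.single_map_f_self _ 0 p
    let e₁ : X ≅ (mappingCone u).X (-2) :=
      { hom := eX.hom ≫ (mappingCone.inl f).v 0 (-1) (by lia) ≫
          (mappingCone.inl u).v (-1) (-2) (by lia)
        inv := (mappingCone.fst u).1.v (-2) (-1) (by lia) ≫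
          (mappingCone.fst f).1.v (-1) 0 (by lia) ≫ eX.inv
        hom_inv_id := by simp
        inv_hom_id := by
          rw [mappingCone.ext_from_iff u (-1) (-2) (by lia)]
          constructor
          · rw [mappingCone.ext_from_iff f 0 (-1) (by lia)]
            exact ⟨by simp, (hS _ _ (by lia)).eq_of_src _ _⟩
          · exact (hS _ _ (by lia)).eq_of_src _ _ }
    let e₂ : Y ≅ (mappingCone u).X (-1) :=
      { hom := eY.hom ≫ (mappingCone.inr f).f 0 ≫ (mappingCone.inl u).v 0 (-1) (by lia)
        inv := (mappingCone.fst u).1.v (-1) 0 (by lia) ≫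
          (mappingCone.snd f).v 0 0 (by lia) ≫ eY.inv
        hom_inv_id := by simp
        inv_hom_id := by
          rw [mappingCone.ext_from_iff u 0 (-1) (by lia)]
          constructor
          · rw [mappingCone.ext_from_iff f 1 0 (by lia)]
            exact ⟨(hS _ _ (by lia)).eq_of_src _ _, by simp⟩
          · exact (hS _ _ (by lia)).eq_of_src _ _ }
    let e₃ : Z ≅ (mappingCone u).X 0 :=
      { hom := eZ.hom ≫ (mappingCone.inr u).f 0
        inv := (mappingCone.snd u).v 0 0 (by lia) ≫ eZ.inv
        hom_inv_id := by simp
        inv_hom_id := by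
          rw [mappingCone.ext_from_iff u 1 0 (by lia)]
          constructor
          · rw [mappingCone.ext_from_iff f 2 1 (by lia)]
            exact ⟨(hS _ _ (by lia)).eq_of_src _ _, (hS _ _ (by lia)).eq_of_src _ _⟩
          · simp }
    -- The outer cone negates the differential of the inner one, so `i` appears with a minus sign.
    have w' : (-i) ≫ p = 0 := by simp [w]
    have h' : E.exact (ShortComplex.mk (-i) p w') :=
      E.exact_of_iso (ShortComplex.isoMk (S₁ := .mk _ _ w) (S₂ := .mk _ _ w')
        ⟨-𝟙 X, -𝟙 X, by simp, by simp⟩ (Iso.refl _) (Iso.refl _) (by simp) (by simp)) h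
    refine E.exact_of_iso (ShortComplex.isoMk (S₁ := .mk _ _ w') (S₂ := .mk _ _ (by simp))
      e₁ e₂ e₃ ?_ ?_) h'
    · simp only [e₁, e₂, assoc]
      rw [mappingCone.inl_v_d u (-1) (-2) 0 (by lia) (by lia), Preadditive.comp_sub,
        mappingCone.inl_v_d_assoc f 0 (-1) 1 (by lia) (by lia)]
      simp [u, hf]
    · simp only [e₂, e₃, assoc]
      rw [mappingCone.inl_v_d u 0 (-1) 1 (by lia) (by lia), Preadditive.comp_sub]
      simp [u, hg]

end ExactStructure

section

variable {A : Type u} [Category.{v} A] [Preadditive A] [HasZeroObject A] [HasBinaryBiproducts A]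

/-- The distinguished triangle in `K^b(A)` given by a mapping cone. -/
lemma exists_distinguished_mappingCone {K L : CochainComplex A ℤ} (φ : K ⟶ L)
    (hK : boundedComplexes A ((HomotopyCategory.quotient _ _).obj K))
    (hL : boundedComplexes A ((HomotopyCategory.quotient _ _).obj L)) :
    ∃ h, Triangle.mk (X := (⟨_, hK⟩ : BoundedHomotopyCategory A))
        ((boundedComplexes A).homMk (Y := ⟨_, hL⟩) ((HomotopyCategory.quotient _ _).map φ))
        ((boundedComplexes A).homMk (Y := ⟨_, boundedComplexes_mappingCone φ hK hL⟩)
          ((HomotopyCategory.quotient _ _).map (CochainComplex.mappingCone.inr φ))) h ∈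
      distTriang (BoundedHomotopyCategory A) := by
  let P := boundedComplexes A
  let X : P.FullSubcategory := ⟨_, hK⟩
  refine ⟨P.homMk ((CochainComplex.mappingCone.triangleh φ).mor₃ ≫
    (P.ι.commShiftIso (1 : ℤ)).inv.app X), ?_⟩
  rw [← P.ι.map_distinguished_iff]
  refine isomorphic_distinguished _
    (HomotopyCategory.mappingCone_triangleh_distinguished φ) _
      (Triangle.isoMk _ _ (Iso.refl _) (Iso.refl _) (Iso.refl _) ?_ ?_ ?_)
  · exact (comp_id _).trans (id_comp _).symm
  · exact (comp_id _).trans (id_comp _).symm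
  · have key {W : HomotopyCategory A (ComplexShape.up ℤ)}
        (m : W ⟶ (P.ι ⋙ shiftFunctor _ (1 : ℤ)).obj X) :
        (m ≫ (P.ι.commShiftIso (1 : ℤ)).inv.app X) ≫ (P.ι.commShiftIso (1 : ℤ)).hom.app X = m := by
      rw [assoc, Iso.inv_hom_id_app, comp_id]
    exact (congrArg (_ ≫ ·) (CategoryTheory.Functor.map_id _ _)).trans
      ((comp_id _).trans ((key _).trans (id_comp _).symm))

end

namespace ExactStructure

variable {A : Type u} [Category.{v} A] [Preadditive A] [HasZeroObject A]
  [HasBinaryBiproducts A] [IsIdempotentComplete A] (E : ExactStructure A)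

/-- The mapping cone of the first morphism of an exact sequence is isomorphic to the third term,
up to acyclic complexes. -/
lemma exists_distinguished_of_exact {X Y Z : A} {i : X ⟶ Y} {p : Y ⟶ Z} {w : i ≫ p = 0}
    (h : E.exact (ShortComplex.mk i p w)) :
    ∃ (K : BoundedHomotopyCategory A) (a : (singleBounded A).obj Y ⟶ K)
      (b : K ⟶ ((singleBounded A).obj X)⟦(1 : ℤ)⟧) (u : K ⟶ (singleBounded A).obj Z),
      Triangle.mk ((singleBounded A).map i) a b ∈ distTriang _ ∧
        a ≫ u = (singleBounded A).map p ∧ E.acyclic.trW u := by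
  let f := (CochainComplex.singleFunctor A 0).map i
  let u := CochainComplex.mappingCone.desc f 0 ((CochainComplex.singleFunctor A 0).map p)
    (by rw [← Functor.map_comp, w]; simp)
  obtain ⟨b, hb⟩ := exists_distinguished_mappingCone f ((singleBounded A).obj X).property
    ((singleBounded A).obj Y).property
  obtain ⟨c, hc⟩ := exists_distinguished_mappingCone u
    (boundedComplexes_mappingCone f ((singleBounded A).obj X).property
      ((singleBounded A).obj Y).property) ((singleBounded A).obj Z).property
  refine ⟨_, _, b, _, hb, ?_, _, _, _, hc, (E.acyclic_iff _).2 (E.isAcyclic_mappingCone_mappingCone h)⟩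
  ext
  change (HomotopyCategory.quotient _ _).map _ ≫ (HomotopyCategory.quotient _ _).map _ =
    (HomotopyCategory.quotient _ _).map _
  rw [← Functor.map_comp, CochainComplex.mappingCone.inr_desc]

/-- An exact sequence gives a distinguished triangle in the bounded derived category. -/
lemma exists_distinguished_single (S : ShortComplex A) (h : E.exact S) :
    ∃ δ, Triangle.mk ((BoundedDerivedCategory.single E).map S.f)
      ((BoundedDerivedCategory.single E).map S.g) δ ∈ distTriang _ := by
  obtain ⟨K, a, b, u, hT, hu, hu'⟩ := E.exists_distinguished_of_exact h
  let L := BoundedDerivedCategory.Qh E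
  have hLu : IsIso (L.map u) := Localization.inverts L E.acyclic.trW u hu'
  let U : L.obj K ≅ L.obj ((singleBounded A).obj S.X₃) := asIso (L.map u)
  refine ⟨U.inv ≫ L.map b ≫ (L.commShiftIso (1 : ℤ)).hom.app _,
    isomorphic_distinguished _ (L.map_distinguished _ hT) _
      (Triangle.isoMk _ _ (Iso.refl _) (Iso.refl _) U.symm ?_ ?_ ?_)⟩
  · exact (comp_id _).trans (id_comp _).symm
  · change L.map ((singleBounded A).map S.g) ≫ U.inv = 𝟙 _ ≫ L.map a
    rw [← hu, L.map_comp, assoc, show L.map u ≫ U.inv = 𝟙 _ from U.hom_inv_id]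
    exact (comp_id _).trans (id_comp _).symm
  · change (U.inv ≫ L.map b ≫ (L.commShiftIso (1 : ℤ)).hom.app _) ≫ (𝟙 _)⟦(1 : ℤ)⟧' =
      U.inv ≫ L.map b ≫ (L.commShiftIso (1 : ℤ)).hom.app _
    rw [CategoryTheory.Functor.map_id]
    exact comp_id _

/-- The full subcategory of `A` given by a thick subcategory of `D^b(A)` is thick. -/
lemma isThick_inverseImage (D : ObjectProperty E.BoundedDerivedCategory)
    (hD : IsThickTriangulated D) :
    E.IsThick (D.inverseImage (BoundedDerivedCategory.single E)) := by
  obtain ⟨hD₁, hD₃, hD⟩ := hD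
  refine ⟨⟨fun r h ↦ D.prop_of_retract (r.map _) h⟩, fun S hS h₂ h₃ ↦ ?_, fun S hS h₁ h₃ ↦ ?_,
    fun S hS h₁ h₂ ↦ ?_⟩
  all_goals obtain ⟨δ, hδ⟩ := E.exists_distinguished_single S hS
  · have := D.ext_of_isTriangulatedClosed₃ _ (rot_of_distTriang _ hδ) h₂ h₃
    exact (D.prop_shift_iff_of_isStableUnderShift _ 1).1 this
  · exact D.ext_of_isTriangulatedClosed₃ _ (inv_rot_of_distTriang _ hδ) (D.le_shift _ _ h₃) h₁
  · exact D.ext_of_isTriangulatedClosed₃ _ hδ h₁ h₂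

end ExactStructure

/-! ### Cofinality and morphisms to acyclic complexes -/

section

variable {A : Type u} [Category.{v} A] [Preadditive A] [HasZeroObject A]

/-- The only nonzero term of a single complex. -/
noncomputable def singleFunctorXIso (X : A) : X ≅ ((CochainComplex.singleFunctor A 0).obj X).X 0 :=
  (HomologicalComplex.singleObjXSelf (.up ℤ) 0 X).symm

lemma singleFunctorXIso_hom_naturality {X Y : A} (f : X ⟶ Y) :
    (singleFunctorXIso X).hom ≫ ((CochainComplex.singleFunctor A 0).map f).f 0 =
      f ≫ (singleFunctorXIso Y).hom := by
  rw [← Iso.eq_inv_comp]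
  exact HomologicalComplex.single_map_f_self (.up ℤ) 0 f

/-- A homotopy on a complex concentrated in degree zero has a single component, namely `y`. -/
lemma quotient_map_eq_zero_of_single {X : A} {N : CochainComplex A ℤ}
    (ψ : (CochainComplex.singleFunctor A 0).obj X ⟶ N) (y : X ⟶ N.X (-1))
    (h : y ≫ N.d (-1) 0 = (singleFunctorXIso X).hom ≫ ψ.f 0) :
    (HomotopyCategory.quotient A (ComplexShape.up ℤ)).map ψ = 0 := by
  rw [HomotopyCategory.quotient_map_eq_zero_iff]
  refine ⟨(CochainComplex.HomComplex.Cochain.equivHomotopy _ _).symm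
    ⟨CochainComplex.HomComplex.Cochain.fromSingleMk y (by lia), ?_⟩⟩
  rw [CochainComplex.HomComplex.Cochain.δ_fromSingleMk _ _ 0 0 (by lia), h,
    CochainComplex.HomComplex.Cochain.ofHom_zero, add_zero]
  apply (CochainComplex.HomComplex.Cochain.fromSingleEquiv (add_zero 0)).injective
  rw [CochainComplex.HomComplex.Cochain.fromSingleEquiv_fromSingleMk]
  exact congrArg (_ ≫ ·) (CochainComplex.HomComplex.Cochain.ofHom_v ψ 0)

end

namespace ExactStructure

variable {A : Type u} [Category.{v} A] [Preadditive A] [HasZeroObject A]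
  [HasBinaryBiproducts A] [IsIdempotentComplete A] (E : ExactStructure A)

variable {E} in
/-- Morphisms from objects of a cofinal thick subcategory `C` to acyclic complexes factor through
an acyclic complex which is built from objects in `C`. -/
lemma IsCofinal.exists_fac {C : ObjectProperty A} (hC : E.IsThick C) (hC' : E.IsCofinal C) (k : ℕ) :
    ∀ {N : BoundedHomotopyCategory A} {N' : CochainComplex A ℤ}
      (_ : N.obj ≅ (HomotopyCategory.quotient _ _).obj N') (_ : E.IsAcyclic N')
      (_ : N'.IsStrictlyGE (1 - k)) {Z : A} (_ : C Z) (g : (singleBounded A).obj Z ⟶ N),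
      ∃ (J : BoundedHomotopyCategory A) (a : (singleBounded A).obj Z ⟶ J) (b : J ⟶ N),
        (C.map (singleBounded A)).triangulatedClosure J ∧ E.acyclic J ∧ a ≫ b = g := by
  induction k with
  | zero =>
    intro N N' e hN hN' Z hZ g
    refine ⟨0, 0, 0, ObjectProperty.prop_zero _, ObjectProperty.prop_zero _, ?_⟩
    rw [zero_comp]
    ext
    obtain ⟨g', hg'⟩ := (HomotopyCategory.quotient A (ComplexShape.up ℤ)).map_surjective
      (X := (CochainComplex.singleFunctor A 0).obj Z) (g.hom ≫ e.hom)
    -- For `k = 0` the complex `N'` starts in degree `1`, so nothing maps to it from degree `0`.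
    have : g' = 0 := by
      apply HomologicalComplex.from_single_hom_ext
      exact (N'.isZero_of_isStrictlyGE (1 - (0 : ℕ)) 0 (by lia)).eq_of_tgt _ _
    rw [this, Functor.map_zero] at hg'
    exact ((cancel_mono e.hom).1 (zero_comp.trans hg'))
  | succ k hk =>
    intro N N' e hN hN' Z hZ g
    obtain ⟨g', hg'⟩ := (HomotopyCategory.quotient A (ComplexShape.up ℤ)).map_surjective
      (X := (CochainComplex.singleFunctor A 0).obj Z) (g.hom ≫ e.hom)
    have hN₁ := hN.shift (-1)
    have hN₂ := CochainComplex.isStrictlyGE_shift N' (1 - ↑(k + 1)) (-1) (1 - ↑k) (by lia)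
    obtain ⟨W, i, p, w, hE, hd⟩ := hN
    let f : Z ⟶ N'.X 0 := (singleFunctorXIso Z).hom ≫ g'.f 0
    have hf : f ≫ p 0 1 (by lia) = 0 := by
      have := mono_of_exact (hE 1 2 (by lia))
      rw [← cancel_mono (i 1), assoc, hd, zero_comp]
      have hd₀ : ((CochainComplex.singleFunctor A 0).obj Z).d 0 1 = 0 :=
        HomologicalComplex.single_obj_d _ _ _ _ _
      rw [assoc, g'.comm, hd₀, zero_comp, comp_zero]
    obtain ⟨l, hl⟩ := exists_lift (hE 0 1 (by lia)) f hf
    -- The morphism `l` into the cycles lifts to `N'.X (-1)` after pulling back along an admissible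
    -- epimorphism. Cofinality replaces this by some `q : Y ⟶ Z` with `Y` in `C`, on which `g`
    -- becomes null-homotopic.
    obtain ⟨Y₁, f', p', sq, hp'⟩ := E.pullback (p (-1) 0 (by lia)) l ⟨_, _, _, hE (-1) 0 (by lia)⟩
    obtain ⟨Y, q, ⟨X, j, wj, hj⟩, hY, φ, hφ⟩ := hC' p' hp' hZ
    have hX : C X := hC.left _ hj hY hZ
    obtain ⟨K, a, b, u, hT, hau, hu⟩ := E.exists_distinguished_of_exact hj
    have hzero : a ≫ u ≫ g = 0 := by
      rw [← assoc, hau]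
      ext
      rw [← cancel_mono e.hom]
      have := quotient_map_eq_zero_of_single ((CochainComplex.singleFunctor A 0).map q ≫ g')
        (φ ≫ f') (by
          rw [HomologicalComplex.comp_f, reassoc_of% (singleFunctorXIso_hom_naturality q), assoc,
            ← hd (-1) 0 (by lia), reassoc_of% sq.w, hl, reassoc_of% hφ])
      rw [Functor.map_comp, hg'] at this
      exact (assoc _ _ _).trans (this.trans zero_comp.symm)
    obtain ⟨ψ, hψ⟩ := exists_desc₃ hT (u ≫ g) hzero
    -- What remains of `g` is a morphism from `X⟦1⟧`, equivalently from `X` to `N⟦-1⟧`. This complex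
    -- starts one degree later, so the induction hypothesis applies. Since shifts are compatible
    -- with the inclusion and quotient functors only up to isomorphism, the induction allows a
    -- representative `N'` of `N`.
    obtain ⟨J, v, t, hJ, hJ', rfl⟩ := ObjectProperty.exists_fac_shift
      (P := (C.map (singleBounded A)).triangulatedClosure) (Q := E.acyclic) (m := -1) (by lia) ψ
      (fun ψ' ↦ hk (((boundedComplexes A).ι.commShiftIso (-1 : ℤ)).app N ≪≫
        (shiftFunctor _ (-1 : ℤ)).mapIso e ≪≫
        (((HomotopyCategory.quotient A (ComplexShape.up ℤ)).commShiftIso (-1 : ℤ)).app N').symm)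
        hN₁ hN₂ hX ψ')
    have hS {c : A} (hc : C c) :
        (C.map (singleBounded A)).triangulatedClosure ((singleBounded A).obj c) :=
      ObjectProperty.le_triangulatedClosure _ _ (C.prop_map_obj _ hc)
    have hK := ObjectProperty.ext_of_isTriangulatedClosed₃ _ _ hT (hS hX) (hS hY)
    -- This factors `u ≫ g`, not `g`. As the cone `V` of `u` is acyclic and lies in the triangulated
    -- closure, the factorization extends along `u`.
    obtain ⟨V, _, _, hT', hV⟩ := hu
    exact ObjectProperty.exists_fac_of_distinguished hT' (ObjectProperty.leftFactorizable_of_prop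
      (ObjectProperty.ext_of_isTriangulatedClosed₃ _ _ hT' hK (hS hZ)) hV) g
      ((E.acyclic_iff N).2 (E.isAcyclic_of_retract_homotopyCategory e.retract
        ⟨W, i, p, w, hE, hd⟩)) (b ≫ v) t hJ hJ' (by rw [assoc, hψ])

variable {E} in
lemma IsCofinal.isVerdierLeftLocalizing {C : ObjectProperty A} (hC : E.IsThick C)
    (hC' : E.IsCofinal C) :
    (C.map (singleBounded A)).triangulatedClosure.IsVerdierLeftLocalizing E.acyclic := by
  refine ObjectProperty.isVerdierLeftLocalizing_triangulatedClosure ?_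
  rintro K ⟨X, hX, ⟨e⟩⟩
  refine ObjectProperty.prop_of_iso _ e (fun N g hN ↦ ?_)
  obtain ⟨a, b, ha, hb⟩ := N.property
  -- The truncation in `toNat` is harmless: if `a > 1`, the bound becomes `1`, which is still at
  -- most `a`.
  have : CochainComplex.IsStrictlyGE N.obj.as (1 - ((1 - a).toNat : ℕ)) :=
    CochainComplex.isStrictlyGE_of_ge N.obj.as _ a (by lia)
  exact hC'.exists_fac hC _ (Iso.refl _) ((E.acyclic_iff N).1 hN) this hX g

end ExactStructure

/-! ### Recovering `C` from bounded complexes with terms in `C` -/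

namespace ExactStructure

variable {A : Type u} [Category.{v} A] [Preadditive A] [HasBinaryBiproducts A]
  [IsIdempotentComplete A] {E : ExactStructure A}

open CochainComplex in
lemma IsThick.prop_mappingCone_X {C : ObjectProperty A} (hC : E.IsThick C)
    {K L : CochainComplex A ℤ} (f : K ⟶ L) {n m : ℤ} (h : n + 1 = m) (hK : C (K.X m))
    (hL : C (L.X n)) : C ((mappingCone f).X n) := by
  refine hC.middle (ShortComplex.mk ((mappingCone.inr f).f n) ((mappingCone.fst f).1.v n m h)
    (by simp)) (exact_of_splitting ⟨(mappingCone.snd f).v n n (add_zero n),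
      (mappingCone.inl f).v m n (by lia), by simp, by simp, ?_⟩) hL hK
  simp [mappingCone.ext_from_iff f _ _ h]

open CochainComplex in
/-- If `f : K ⟶ M` has an acyclic mapping cone, where the terms of the bounded below complex `K`
belong to a thick subcategory, `M` vanishes in degrees `< -1` and its differential in degree `-1`
is zero, then the term of degree `-1` of `M` belongs to this subcategory. -/
lemma IsThick.prop_of_isAcyclic_mappingCone {C : ObjectProperty A} (hC : E.IsThick C)
    {K M : CochainComplex A ℤ} (f : K ⟶ M) (hf : E.IsAcyclic (mappingCone f))
    (hK : ∀ n, C (K.X n)) (a : ℤ) (ha : ∀ n < a, IsZero (K.X n))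
    (hM : ∀ n < -1, IsZero (M.X n)) (hd : M.d (-1) 0 = 0) : C (M.X (-1)) := by
  have := hC.retract
  have hC₀ {X : A} (hX : IsZero X) : C X :=
    C.prop_of_iso ((ha (a - 1) (by lia)).iso hX) (hK (a - 1))
  obtain ⟨Z, i, p, w, hE, hd'⟩ := hf
  have hZ₀ (n : ℤ) (hn : n < a - 1) (hn' : n < -1) : C (Z n) := by
    have := mono_of_exact (hE n _ rfl)
    have : IsZero ((mappingCone f).X n) := by
      rw [mappingCone.isZero_X_iff]
      exact ⟨ha _ (by lia), hM _ hn'⟩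
    exact hC₀ (by rw [IsZero.iff_id_eq_zero, ← cancel_mono (i n)]; exact this.eq_of_tgt _ _)
  -- Cycles propagate to the right by closure under cokernels. The restriction `n ≤ -1` is
  -- essential: the terms of the cone used lie in degrees `< -1`, where `M` vanishes and contributes
  -- nothing outside `C`.
  have hZ (k : ℕ) : ∀ n : ℤ, n < min a 0 - 1 + k → n ≤ -1 → C (Z n) := by
    induction k with
    | zero => exact fun n hn hn' ↦ hZ₀ n (by lia) (by lia)
    | succ k hk =>
      intro n hn hn'
      exact hC.right _ (hE (n - 1) n (by lia)) (hk _ (by lia) (by lia))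
        (hC.prop_mappingCone_X f (show n - 1 + 1 = n by lia) (hK _) (hC₀ (hM _ (by lia))))
  have hi₀ := mono_of_exact (hE 0 1 (by lia))
  -- Because the differential of `M` vanishes here, `M.X (-1)` embeds in the cycles of the cone. The
  -- second projection of the cone splits this embedding.
  obtain ⟨l, hl⟩ := exists_lift (hE (-1) 0 (by lia)) ((mappingCone.inr f).f (-1)) (by
    rw [← cancel_mono (i 0), assoc, hd', mappingCone.inr_f_d, hd, zero_comp, zero_comp])
  exact C.prop_of_retract ⟨l, i (-1) ≫ (mappingCone.snd f).v (-1) (-1) (by lia),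
    by rw [reassoc_of% hl, mappingCone.inr_f_snd_v]⟩ (hZ (1 - min a 0).toNat (-1) (by lia) (by lia))

variable [HasZeroObject A]

/-- The objects of `K^b(A)` which are isomorphic to bounded complexes with terms in `C`. -/
def boundedComplexesIn (C : ObjectProperty A) : ObjectProperty (BoundedHomotopyCategory A) :=
  fun K ↦ ∃ K' : CochainComplex A ℤ, (∀ n, C (K'.X n)) ∧
    boundedComplexes A ((HomotopyCategory.quotient _ _).obj K') ∧
    Nonempty (K.obj ≅ (HomotopyCategory.quotient _ _).obj K')

instance (C : ObjectProperty A) : (boundedComplexesIn C).IsClosedUnderIsomorphisms where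
  of_iso := by
    rintro K L e ⟨K', h, h', ⟨e'⟩⟩
    exact ⟨K', h, h', ⟨(boundedComplexes A).ι.mapIso e.symm ≪≫ e'⟩⟩

/-- Morphisms in `K^b(A)` lift to chain maps, and the terms of a cone are split extensions of terms
in `C`. The object `X` ensures that `C` contains the zero objects. -/
lemma IsThick.isTriangulated_boundedComplexesIn {C : ObjectProperty A} (hC : E.IsThick C)
    {X : A} (hX : C X) : (boundedComplexesIn C).IsTriangulated := by
  have := hC.retract
  have hC₀ {Y : A} (hY : IsZero Y) : C Y :=
    C.prop_of_retract ⟨0, 0, hY.eq_of_src _ _⟩ hX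
  have hs : (boundedComplexesIn C).IsStableUnderShift ℤ := ⟨fun n ↦ ⟨by
    rintro K ⟨K', h, h', ⟨e⟩⟩
    have hs := (boundedComplexes A).le_shift n _ h'
    rw [ObjectProperty.prop_shift_iff, HomotopyCategory.shift_quotient_obj] at hs
    exact ⟨K'⟦n⟧, fun m ↦ h (m + n), hs, ⟨((boundedComplexes A).ι.commShiftIso n).app K ≪≫
      (shiftFunctor _ n).mapIso e ≪≫
      (((HomotopyCategory.quotient A (ComplexShape.up ℤ)).commShiftIso n).app K').symm⟩⟩⟩⟩
  have h₃ : (boundedComplexesIn C).IsTriangulatedClosed₃ := .mk' (by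
    rintro T hT ⟨K, hK, hK', ⟨e⟩⟩ ⟨L, hL, hL', ⟨e'⟩⟩
    obtain ⟨φ, hφ⟩ := (HomotopyCategory.quotient A (ComplexShape.up ℤ)).map_surjective
      (e.inv ≫ T.mor₁.hom ≫ e'.hom)
    obtain ⟨c, hc⟩ := exists_distinguished_mappingCone φ hK' hL'
    obtain ⟨e'', -⟩ := exists_iso_of_arrow_iso _ _ hc hT
      (Arrow.isoMk ((boundedComplexes A).isoMk (X := ⟨_, hK'⟩) e.symm)
        ((boundedComplexes A).isoMk (X := ⟨_, hL'⟩) e'.symm) (by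
          ext
          change e.inv ≫ T.mor₁.hom = (HomotopyCategory.quotient _ _).map φ ≫ e'.inv
          rw [hφ, assoc, assoc, e'.hom_inv_id]
          exact congrArg (e.inv ≫ ·) (comp_id _).symm))
    exact ⟨_, fun n ↦ hC.prop_mappingCone_X φ rfl (hK _) (hL _),
      boundedComplexes_mappingCone φ hK' hL',
      ⟨(boundedComplexes A).ι.mapIso (Triangle.π₃.mapIso e'').symm⟩⟩)
  have h₂ : (boundedComplexesIn C).IsTriangulatedClosed₂ := .of_isTriangulatedClosed₃
  exact {
    exists_zero := ⟨0, isZero_zero _, 0, fun n ↦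
      hC₀ (Functor.map_isZero (HomologicalComplex.eval A _ n) (isZero_zero _)),
      ⟨0, 0, inferInstanceAs (CochainComplex.IsStrictlyGE (0 : CochainComplex A ℤ) 0),
        inferInstanceAs (CochainComplex.IsStrictlyLE (0 : CochainComplex A ℤ) 0)⟩,
      ⟨IsZero.iso (Functor.map_isZero (boundedComplexes A).ι (isZero_zero _))
        (Functor.map_isZero (HomotopyCategory.quotient _ _) (isZero_zero _))⟩⟩ }

lemma IsThick.triangulatedClosure_le {C : ObjectProperty A} (hC : E.IsThick C) {X : A}
    (hX : C X) : (C.map (singleBounded A)).triangulatedClosure ≤ boundedComplexesIn C := by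
  have := hC.isTriangulated_boundedComplexesIn hX
  have := hC.retract
  refine ObjectProperty.triangulatedClosure_le ?_
  rintro K ⟨Y, hY, ⟨e⟩⟩
  refine ObjectProperty.prop_of_iso _ e ⟨(CochainComplex.singleFunctor A 0).obj Y, fun n ↦ ?_,
    ((singleBounded A).obj Y).property, ⟨Iso.refl _⟩⟩
  by_cases hn : n = 0
  · subst hn
    exact C.prop_of_iso (singleFunctorXIso Y) hY
  · have : IsZero (((CochainComplex.singleFunctor A 0).obj Y).X n) :=
      HomologicalComplex.isZero_single_obj_X _ _ _ _ hn
    exact C.prop_of_retract ⟨0, 0, this.eq_of_src _ _⟩ hX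

variable (E) in
lemma isAcyclic_mappingCone_of_trW {K L : CochainComplex A ℤ} (φ : K ⟶ L)
    (hK : boundedComplexes A ((HomotopyCategory.quotient _ _).obj K))
    (hL : boundedComplexes A ((HomotopyCategory.quotient _ _).obj L))
    (h : E.acyclic.trW ((boundedComplexes A).homMk (X := ⟨_, hK⟩) (Y := ⟨_, hL⟩)
      ((HomotopyCategory.quotient _ _).map φ))) :
    E.IsAcyclic (CochainComplex.mappingCone φ) := by
  obtain ⟨c, hc⟩ := exists_distinguished_mappingCone φ hK hL
  exact (E.acyclic_iff _).1 ((E.acyclic.trW_iff_of_distinguished _ hc).1 h)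

/-- The target is modelled by a complex with `X` in degrees `-1` and `0` and zero differential.
Acyclicity of the cone then detects the copy of `X` in degree `-1`. -/
lemma IsThick.prop_of_trW {C : ObjectProperty A} (hC : E.IsThick C)
    {K : BoundedHomotopyCategory A} (hK : boundedComplexesIn C K) {X : A}
    (f : K ⟶ ((singleBounded A).obj X)⟦(1 : ℤ)⟧ ⊞ (singleBounded A).obj X)
    (hf : E.acyclic.trW f) : C X := by
  obtain ⟨K', hK', hb, ⟨e⟩⟩ := hK
  let Q := HomotopyCategory.quotient A (ComplexShape.up ℤ)
  let ι := (boundedComplexes A).ι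
  let S := (CochainComplex.singleFunctor A 0).obj X
  let M := S⟦(1 : ℤ)⟧ ⊞ S
  have := preservesBinaryBiproducts_of_preservesBiproducts ι
  have := preservesBinaryBiproducts_of_preservesBiproducts Q
  let e' : ι.obj (((singleBounded A).obj X)⟦(1 : ℤ)⟧ ⊞ (singleBounded A).obj X) ≅ Q.obj M :=
    ι.mapBiprod _ _ ≪≫
      biprod.mapIso ((ι.commShiftIso (1 : ℤ)).app _ ≪≫ ((Q.commShiftIso (1 : ℤ)).app S).symm)
        (Iso.refl _) ≪≫ (Q.mapBiprod _ _).symm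
  have hS (n : ℤ) (hn : n ≠ 0) : IsZero (S.X n) := HomologicalComplex.isZero_single_obj_X _ _ _ _ hn
  have hS' (n : ℤ) (hn : n ≠ -1) : IsZero ((S⟦(1 : ℤ)⟧).X n) := hS (n + 1) (by lia)
  have hM (n : ℤ) (hn : n ≠ 0) (hn' : n ≠ -1) : IsZero (M.X n) :=
    IsZero.of_iso ((biprod_isZero_iff _ _).2 ⟨hS' n hn', hS n hn⟩)
      (HomologicalComplex.biprodXIso _ _ n)
  have hMb : boundedComplexes A (Q.obj M) :=
    ⟨-1, 0, (CochainComplex.isStrictlyGE_iff M _).2 (fun n hn ↦ hM n (by lia) (by lia)),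
      (CochainComplex.isStrictlyLE_iff M _).2 (fun n hn ↦ hM n (by lia) (by lia))⟩
  obtain ⟨φ, hφ⟩ := Q.map_surjective (e.inv ≫ f.hom ≫ e'.hom)
  have hcone := E.isAcyclic_mappingCone_of_trW φ hb hMb (by
    refine (E.acyclic.trW.arrow_mk_iso_iff (Arrow.isoMk ((boundedComplexes A).isoMk (Y := ⟨_, hb⟩) e)
      ((boundedComplexes A).isoMk (Y := ⟨_, hMb⟩) e') ?_)).1 hf
    ext
    change e.hom ≫ Q.map φ = f.hom ≫ e'.hom
    rw [hφ, e.hom_inv_id_assoc])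
  obtain ⟨a, _, ha, _⟩ := hb
  have : CochainComplex.IsStrictlyGE K' a := ha
  have hd : M.d (-1) 0 = 0 := by
    have h₁ : (S⟦(1 : ℤ)⟧).d (-1) 0 = 0 := (hS' 0 (by lia)).eq_of_tgt _ _
    have h₂ : S.d (-1) 0 = 0 := (hS (-1) (by lia)).eq_of_src _ _
    rw [← cancel_epi (HomologicalComplex.biprodXIso (S⟦(1 : ℤ)⟧) S (-1)).inv]
    apply biprod.hom_ext'
    · rw [HomologicalComplex.inl_biprodXIso_inv_assoc, HomologicalComplex.Hom.comm, h₁]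
      exact zero_comp.trans ((congrArg _ comp_zero).trans comp_zero).symm
    · rw [HomologicalComplex.inr_biprodXIso_inv_assoc, HomologicalComplex.Hom.comm, h₂]
      exact zero_comp.trans ((congrArg _ comp_zero).trans comp_zero).symm
  have hMC := hC.prop_of_isAcyclic_mappingCone φ hcone hK' a
    (fun n hn ↦ K'.isZero_of_isStrictlyGE a n hn) (fun n hn ↦ hM n (by lia) (by lia)) hd
  have := hC.retract
  have hSC : C ((S⟦(1 : ℤ)⟧).X (-1)) := C.prop_of_retract
    ⟨(biprod.inl : S⟦(1 : ℤ)⟧ ⟶ M).f (-1), (biprod.fst : M ⟶ S⟦(1 : ℤ)⟧).f (-1), by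
      rw [← HomologicalComplex.comp_f, biprod.inl_fst]
      rfl⟩ hMC
  exact C.prop_of_iso (singleFunctorXIso X).symm hSC

variable (E) in
/-- A cofinal thick subcategory of `A` is given by a thick subcategory of `D^b(A)`. -/
lemma exists_isThickTriangulated (C : ObjectProperty A) (hC : E.IsThick C) (hC' : E.IsCofinal C) :
    ∃ D : ObjectProperty E.BoundedDerivedCategory, IsThickTriangulated D ∧
      C = D.inverseImage (BoundedDerivedCategory.single E) := by
  by_cases hC₀ : ∃ X, C X
  · obtain ⟨X₀, hX₀⟩ := hC₀
    let L := BoundedDerivedCategory.Qh E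
    let P := (C.map (singleBounded A)).triangulatedClosure
    have : P.IsVerdierLeftLocalizing E.acyclic := hC'.isVerdierLeftLocalizing hC
    have : (P.map L).IsTriangulated :=
      ObjectProperty.isTriangulated_map_of_isVerdierLeftLocalizing L E.acyclic
    refine ⟨(P.map L).retractClosure, ⟨inferInstance, inferInstance, inferInstance⟩, ?_⟩
    ext X
    constructor
    · intro hX
      exact ObjectProperty.le_retractClosure _ _ (P.prop_map_obj L
        (ObjectProperty.le_triangulatedClosure _ _ (C.prop_map_obj _ hX)))
    · rintro ⟨Y, hY, ⟨r⟩⟩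
      -- Passing to `X⟦1⟧ ⊞ X` trades a retract for an actual isomorphism with the image of an
      -- object of `P`, which can be lifted to a fraction.
      obtain ⟨K, hK, ⟨e⟩⟩ := ObjectProperty.shift_biprod_of_retract r hY
      let S := (singleBounded A).obj X
      have := preservesBinaryBiproducts_of_preservesBiproducts L
      let e' : L.obj K ≅ L.obj (S⟦(1 : ℤ)⟧ ⊞ S) := e ≪≫
        biprod.mapIso ((L.commShiftIso (1 : ℤ)).app S).symm (Iso.refl _) ≪≫ (L.mapBiprod _ _).symm
      obtain ⟨K₁, s, f, hK₁, hs, hsf⟩ :=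
        ObjectProperty.exists_rightFraction_of_isVerdierLeftLocalizing (P := P) (Q := E.acyclic)
          L hK e'.hom
      have := Localization.inverts L E.acyclic.trW s hs
      have : IsIso (L.map f) := by rw [← hsf]; infer_instance
      exact hC.prop_of_trW (hC.triangulatedClosure_le hX₀ _ hK₁) f
        (ObjectProperty.trW_of_isIso_map L f)
  -- Thickness as defined does not force a zero object, so the empty `C` is possible. The
  -- construction above would contain zero, so the empty subcategory is used instead.
  · refine ⟨⊥, ⟨⟨fun n ↦ ⟨by rintro _ ⟨⟩⟩⟩, ⟨by rintro _ _ ⟨⟩⟩, ⟨by rintro _ _ _ ⟨⟩⟩⟩, ?_⟩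
    ext X
    exact ⟨fun hX ↦ (hC₀ ⟨X, hX⟩).elim, by rintro ⟨⟩⟩

end ExactStructure

theorem mainTheorem6 {A : Type*} [Category* A] [Preadditive A] [HasZeroObject A]
    [HasBinaryBiproducts A] [IsIdempotentComplete A] (E : ExactStructure A)
    (C : ObjectProperty A) :
    (E.IsThick C → E.IsCofinal C →
      ∃ D : ObjectProperty E.BoundedDerivedCategory, IsThickTriangulated D ∧
        C = D.inverseImage (ExactStructure.BoundedDerivedCategory.single E)) ∧
    (∀ D : ObjectProperty E.BoundedDerivedCategory, IsThickTriangulated D →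
      C = D.inverseImage (ExactStructure.BoundedDerivedCategory.single E) → E.IsThick C) :=
  ⟨E.exists_isThickTriangulated C, fun D hD h ↦ h ▸ E.isThick_inverseImage D hD⟩
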